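/- \textbf{Setting.} Let $\|\cdot\|$ be a norm on $\mathbb R^d$ with dual norm $\|y\|_*=\sup_{\|u\|\le1}\langle y,u\rangle$, and let $\rho=\sup_{z\ne0}\|z\|_*/\|z\|_2$. Let $\mathrm{lmo}$ be a (measurable) selection $\mathrm{lmo}(y)\in\arg\min_{\|u\|\le 1}\langle y,u\rangle$ for $y\neq0$, with $\mathrm{lmo}(0)=0$. Let $f(x)=\mathbb E_{\xi\sim\mathcal D}f(x;\xi)$ be differentiable with $f\ge f^*>-\infty$, where every $f(\cdot;\xi)$ is differentiable, $\mathbb E\nabla f(x;\xi)=\nabla f(x)$ and $\mathbb E\|\nabla f(x;\xi)-\nabla f(x)\|_2^2\le\sigma^2$ for all $x$. Assume that for some $L_0,L_1\ge0$ and all $x,y$, $$\|\nabla f(x)-\nabla f(y)\|_*\le\sup_{\theta\in[0,1]}\bigl(L_0+L_1\|\nabla f(\theta x+(1-\theta)y)\|_*\bigr)\,\|x-y\|,$$ the supremum being finite. Given a starting point $x_0$, put $\Delta_0=f(x_0)-f^*$. \textbf{Method.} A server and workers $1,\dots,n$ start with iterate $x_0$, and every worker starts computing a stochastic gradient at $x_0$.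 Suppose that the server has made $k$ updates when a gradient arrives from worker $i$, computed at $x_{k-\delta}$. If $\delta<R_k$, it is accepted as $g_k$; the server sets $m_{k+1}=(1-\alpha_k)m_k+\alpha_kg_k$ (for $k=0$: $m_1=(1-\alpha_0)m_0+\alpha_{\mathrm{init}}g_0$) and $x_{k+1}=x_k+\eta_k\,\mathrm{lmo}(m_{k+1})$, and worker $i$ starts a computation at $x_{k+1}$. If $\delta\ge R_k$, the gradient is discarded and worker $i$ starts a computation at $x_k$. Every computation uses a fresh independent sample $\xi\sim\mathcal D$, and communication takes no time. The parameters are $\alpha_0=\alpha_{\mathrm{init}}=R_0=1$, and $\alpha_k=1/\sqrt k$, $R_k=\sqrt k$ for $k\ge1$, and $\eta_k=h\,(k+1)^{-3/4}$ for $k\ge 0$. The scale $h$ and the quantity $\Psi$ are given by one of the following: \begin{itemize} \item $L_1=0$, $h=\eta$ for some $\eta>0$, and $\Psi=\Delta_0/\eta+\rho\sigma+L_0\eta$; \item $L_1>0$, $h=\eta/17$ for some $\eta>0$, and $\Psi=e^{L_1^2\eta^2}\Delta_0/\eta+\rho\sigma+e^{L_1^2\eta^2}L_0\eta$; \item $L_1>0$,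 $h=1/(17L_1)$, and $\Psi=L_1\Delta_0+\rho\sigma+L_0/L_1$. \end{itemize} \textbf{Universal computation model.} Worker $i$ has a rate $p_i:\mathbb R_+\to\mathbb R_+$ that is continuous almost everywhere and integrable on bounded intervals. It computes without pause, and the number of gradients it completes in $[0,t]$ is $\lfloor\int_0^tp_i(s)\,ds\rfloor$ for every $t\ge0$; equivalently, a computation started at time $T_1$ is completed at the first $T_2$ with $\int_{T_1}^{T_2}p_i(s)\,ds=1$. Simultaneous arrivals are processed in an arbitrary order. For an integer $R\ge 1$ and $T_0\ge0$ put $$t(R;T_0)=\min\Bigl\{t\ge0:\ \sum_{i=1}^n\Bigl\lfloor\tfrac14\int_{T_0}^{T_0+t}p_i(s)\,ds\Bigr\rfloor\ge R\Bigr\}$$ ($+\infty$ if there is no such $t$), and define $S_0=0$ and $S_j=S_{j-1}+t\bigl(\max\{1,\lceil (j-1)/3\rceil\};S_{j-1}\bigr)$ for $j\ge1$ (with $S_j=+\infty$ if $S_{j-1}=+\infty$). Let $T(K)\in[0,\infty]$ be the time at which the first $K$ updates have been made. \textbf{Theorem.} There is a universal constant $C>0$ such that the following holds in every such setting and for every $\varepsilon>0$.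 Let $K_\varepsilon$ be the least $K\ge1$ with $\min_{0\le k<K}\mathbb E\|\nabla f(x_k)\|_*\le\varepsilon$. Then $K_\varepsilon$ exists, $$K_\varepsilon\le C\Bigl(1+\frac{\Psi^4}{\varepsilon^4}\bigl(1+\log(1+\tfrac{\Psi}{\varepsilon})\bigr)^4\Bigr),$$ and the time $T_\varepsilon=T(K_\varepsilon)$ to reach an $\varepsilon$-stationary point satisfies $$T_\varepsilon\le S_{3\lfloor\sqrt{K_\varepsilon}\rfloor+1},\qquad 3\lfloor\sqrt{K_\varepsilon}\rfloor+1\le C\Bigl(1+\frac{\Psi^2}{\varepsilon^2}\bigl(1+\log(1+\tfrac{\Psi}{\varepsilon})\bigr)^2\Bigr)=\widetilde{\mathcal O}\bigl(\Psi^2/\varepsilon^2\bigr).$$ (If only finitely many gradients are ever completed, the sequence of arrivals is continued formally by arrivals at time $+\infty$, so that $x_k$ is defined for every $k$, with $T(k)=+\infty$ for the updates that are never made.) -/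

import Mathlib

open MeasureTheory ProbabilityTheory
open scoped ENNReal NNReal InnerProductSpace

noncomputable section

/-! ### Geometry: dual norm, linear minimization oracle, norm-equivalence constant -/

/-- The parameter space `ℝ^d` with its Euclidean structure. -/
abbrev Vec (d : ℕ) : Type := EuclideanSpace ℝ (Fin d)

/-- A norm on `ℝ^d`, not necessarily the Euclidean one. -/
def IsNorm {d : ℕ} (N : Seminorm ℝ (Vec d)) : Prop := ∀ x, N x = 0 → x = 0

/-- The dual norm `‖y‖_* = sup {⟪y, u⟫ : N u ≤ 1}`. -/
def dualNorm {d : ℕ} (N : Seminorm ℝ (Vec d)) (y : Vec d) : ℝ :=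
  sSup ((fun u : Vec d => ⟪y, u⟫_ℝ) '' {u | N u ≤ 1})

/-- `lmo` is a linear minimization oracle for the unit ball of `N`: it selects a minimizer of
`u ↦ ⟪y, u⟫` over the ball for every `y ≠ 0`, and `lmo 0 = 0`. -/
def IsLMO {d : ℕ} (N : Seminorm ℝ (Vec d)) (lmo : Vec d → Vec d) : Prop :=
  lmo 0 = 0 ∧ ∀ y, y ≠ 0 → N (lmo y) ≤ 1 ∧ ∀ u, N u ≤ 1 → ⟪y, lmo y⟫_ℝ ≤ ⟪y, u⟫_ℝ

/-- `ρ = sup_{z ≠ 0} ‖z‖_* / ‖z‖₂`. -/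
def normConst {d : ℕ} (N : Seminorm ℝ (Vec d)) : ℝ :=
  ⨆ z : {z : Vec d // z ≠ 0}, dualNorm N z.1 / ‖z.1‖

/-! ### Objective and oracle -/

/-- The objective `f(x) = E_{ξ ∼ D} f(x; ξ)`. -/
def objective {d : ℕ} {Ξ : Type*} [MeasurableSpace Ξ] (F : Vec d → Ξ → ℝ) (D : Measure Ξ)
    (x : Vec d) : ℝ := ∫ s, F x s ∂D

/-- The stochastic gradient `∇f(x; ξ)` (gradient in the first argument). -/
def stochGrad {d : ℕ} {Ξ : Type*} (F : Vec d → Ξ → ℝ) (x : Vec d) (s : Ξ) : Vec d :=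
  gradient (fun y => F y s) x

/-- The loss is differentiable in `x` for every sample, the objective is well defined and
differentiable, and the stochastic gradients are unbiased with variance at most `σ²`. -/
structure UnbiasedBoundedVariance {d : ℕ} {Ξ : Type*} [MeasurableSpace Ξ]
    (F : Vec d → Ξ → ℝ) (D : Measure Ξ) (σ : ℝ) : Prop where
  measurable_loss : ∀ x, Measurable (F x)
  integrable_loss : ∀ x, Integrable (F x) D
  differentiable_loss : ∀ s, Differentiable ℝ (fun x => F x s)
  differentiable_objective : Differentiable ℝ (objective F D)
  integrable_grad : ∀ x, Integrable (stochGrad F x) D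
  unbiased : ∀ x, ∫ s, stochGrad F x s ∂D = gradient (objective F D) x
  integrable_sq : ∀ x, Integrable (fun s => ‖stochGrad F x s - gradient (objective F D) x‖ ^ 2) D
  variance_le : ∀ x, ∫ s, ‖stochGrad F x s - gradient (objective F D) x‖ ^ 2 ∂D ≤ σ ^ 2

/-- Symmetric `(L₀, L₁)`-smoothness of `f` with respect to `N`; the supremum over the segment is
required to be finite. -/
def IsGenSmooth {d : ℕ} (N : Seminorm ℝ (Vec d)) (f : Vec d → ℝ) (L₀ L₁ : ℝ) : Prop :=
  ∀ x y : Vec d,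
    BddAbove (Set.range fun θ : Set.Icc (0 : ℝ) 1 =>
      L₀ + L₁ * dualNorm N (gradient f (θ.1 • x + (1 - θ.1) • y))) ∧
    dualNorm N (gradient f x - gradient f y) ≤
      (⨆ θ : Set.Icc (0 : ℝ) 1,
        (L₀ + L₁ * dualNorm N (gradient f (θ.1 • x + (1 - θ.1) • y)))) * N (x - y)

/-! ### Universal computation model -/

/-- A computation rate `p : ℝ₊ → ℝ₊` (only the values on `[0, ∞)` are used): nonnegative,
continuous almost everywhere, and with a finite integral over every bounded interval, so that
only finitely many gradients are computed in finite time. -/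
structure IsComputationRate (p : ℝ → ℝ) : Prop where
  nonneg : ∀ s, 0 ≤ s → 0 ≤ p s
  ae_continuousAt : ∀ᵐ s : ℝ, 0 < s → ContinuousAt p s
  integrable : ∀ T, 0 ≤ T → IntervalIntegrable p volume 0 T

/-- The number `⌊∫_{T₁}^{T₂} p⌋` of gradients a worker with rate `p` completes in `[T₁, T₂]`. -/
def numGradients (p : ℝ → ℝ) (T₁ T₂ : ℝ) : ℕ := ⌊∫ s in T₁..T₂, p s⌋₊

/-- The time at which a worker that computes without pause from time `0` completes its `j`-th
gradient, i.e. the first `t` with `j ≤ numGradients p 0 t`; it is `⊤` if that never happens. -/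
def completionTime (p : ℝ → ℝ) (j : ℕ) : ℝ≥0∞ :=
  ⨅ (t : ℝ≥0) (_ : j ≤ numGradients p 0 t), (t : ℝ≥0∞)

/-- The number of the first `l` arrivals at the server that came from worker `i`, where `w l` is
the worker whose gradient is the `l`-th to arrive (counting from `0`). -/
def received {n : ℕ} (w : ℕ → Fin n) (l : ℕ) (i : Fin n) : ℕ :=
  ((Finset.range l).filter fun l' => w l' = i).card

/-- The time of the `l`-th arrival. Communication is instantaneous and a worker starts its next
computation as soon as the server has handled its previous gradient, so workers never idle. -/
def arrivalTime {n : ℕ} (p : Fin n → ℝ → ℝ) (w : ℕ → Fin n) (l : ℕ) : ℝ≥0∞ :=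
  completionTime (p (w l)) (received w l (w l) + 1)

/-- `w` is an order in which the gradients arrive under the rates `p`: the next arrival is always
an earliest pending one, ties being broken arbitrarily. If only finitely many gradients are ever
completed, the order is continued formally by arrivals at time `⊤`. -/
def IsArrivalOrder {n : ℕ} (p : Fin n → ℝ → ℝ) (w : ℕ → Fin n) : Prop :=
  ∀ l i, arrivalTime p w l ≤ completionTime (p i) (received w l i + 1)

/-- `t(R; T₀)`: the least time `t` with `∑ i, ⌊(1/4) ∫_{T₀}^{T₀ + t} p i⌋ ≥ R`, `⊤` if none. -/
def blockDuration {n : ℕ} (p : Fin n → ℝ → ℝ) (R : ℕ) (T₀ : ℝ) : ℝ≥0∞ :=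
  ⨅ (t : ℝ≥0) (_ : R ≤ ∑ i, ⌊(1 / 4 : ℝ) * ∫ s in T₀..(T₀ + t), p i s⌋₊), (t : ℝ≥0∞)

/-- `S₀ = 0`, `S_j = S_{j-1} + t(max {1, ⌈(j-1)/3⌉}; S_{j-1})`. (Once `S_{j-1} = ⊤`, also
`S_j = ⊤`, whatever the second summand is.) -/
def timeBound {n : ℕ} (p : Fin n → ℝ → ℝ) : ℕ → ℝ≥0∞
  | 0 => 0
  | j + 1 => timeBound p j + blockDuration p (max 1 ⌈(j : ℝ) / 3⌉₊) (timeBound p j).toReal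

/-! ### The asynchronous LMO method -/

/-- Stepsizes `η k`, momentum parameters `α k` and `αinit`, delay thresholds `R k`. -/
structure Schedule where
  η : ℕ → ℝ
  α : ℕ → ℝ
  αinit : ℝ
  R : ℕ → ℝ

/-- `η_k = h / (k+1)^{3/4}`, `α_0 = αinit = 1`, `R_0 = 1`, and `α_k = 1/√k`, `R_k = √k` for
`k ≥ 1`. -/
def sqrtSchedule (h : ℝ) : Schedule where
  η k := h / ((k : ℝ) + 1) ^ (3 / 4 : ℝ)
  α k := if k = 0 then 1 else 1 / √(k : ℝ)
  αinit := 1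
  R k := if k = 0 then 1 else √(k : ℝ)

/-- Bookkeeping of the server: the number `count` of model updates made so far, and for every
worker the index of the iterate at which its current gradient is being computed. -/
structure ServerLog (n : ℕ) where
  count : ℕ
  origin : Fin n → ℕ

/-- The bookkeeping after `l` arrivals. The gradient arriving from worker `i` has delay
`count - origin i`. It is accepted, and the model is updated, iff the delay is below the current
threshold; in either case worker `i` restarts at the newest iterate. -/
def serverLog {n : ℕ} (R : ℕ → ℝ) (w : ℕ → Fin n) : ℕ → ServerLog n
  | 0 => ⟨0, fun _ => 0⟩
  | l + 1 =>
    let s := serverLog R w l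
    let k := if (s.count : ℝ) - s.origin (w l) < R s.count then s.count + 1 else s.count
    ⟨k, Function.update s.origin (w l) k⟩

/-- The arrival that triggers the update from `x_k` to `x_{k+1}`. -/
def acceptedArrival {n : ℕ} (R : ℕ → ℝ) (w : ℕ → Fin n) (k : ℕ) : ℕ :=
  sInf {l | k < (serverLog R w (l + 1)).count}

/-- The worker `i_k` whose gradient is used in the update from `x_k` to `x_{k+1}`. -/
def acceptedWorker {n : ℕ} (R : ℕ → ℝ) (w : ℕ → Fin n) (k : ℕ) : Fin n :=
  w (acceptedArrival R w k)

/-- The index `k - δ_k` of the iterate at which the gradient used in the update from `x_k` to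
`x_{k+1}` was computed. -/
def acceptedOrigin {n : ℕ} (R : ℕ → ℝ) (w : ℕ → Fin n) (k : ℕ) : ℕ :=
  (serverLog R w (acceptedArrival R w k)).origin (acceptedWorker R w k)

/-- The iterates and the momentum after `k` updates: the first component maps `j ≤ k` to `x_j`,
the second one is `m_k`. Here `grad x s` is the stochastic gradient at `x` with sample `s`, and
`ξ j i` is the sample that worker `i` uses for its computation at `x_j`. -/
def trajectory {d n : ℕ} {Ξ : Type*} (P : Schedule) (w : ℕ → Fin n) (lmo : Vec d → Vec d)
    (grad : Vec d → Ξ → Vec d) (x₀ m₀ : Vec d) (ξ : ℕ → Fin n → Ξ) : ℕ → (ℕ → Vec d) × Vec d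
  | 0 => (fun _ => x₀, m₀)
  | k + 1 =>
    let x := (trajectory P w lmo grad x₀ m₀ ξ k).1
    let m := (trajectory P w lmo grad x₀ m₀ ξ k).2
    let o := acceptedOrigin P.R w k
    let g := grad (x o) (ξ o (acceptedWorker P.R w k))
    let m' := if k = 0 then (1 - P.α 0) • m + P.αinit • g else (1 - P.α k) • m + P.α k • g
    (Function.update x (k + 1) (x k + P.η k • lmo m'), m')

/-- The iterate `x_k`. -/
def lmoIterate {d n : ℕ} {Ξ : Type*} (P : Schedule) (w : ℕ → Fin n) (lmo : Vec d → Vec d)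
    (grad : Vec d → Ξ → Vec d) (x₀ m₀ : Vec d) (ξ : ℕ → Fin n → Ξ) (k : ℕ) : Vec d :=
  (trajectory P w lmo grad x₀ m₀ ξ k).1 k

/-- The time `T(K)` at which the first `K ≥ 1` updates have been completed. -/
def updateTime {n : ℕ} (R : ℕ → ℝ) (p : Fin n → ℝ → ℝ) (w : ℕ → Fin n) (K : ℕ) : ℝ≥0∞ :=
  ⨅ (l : ℕ) (_ : K ≤ (serverLog R w (l + 1)).count), arrivalTime p w l

/-! ### Stationarity and the parameter choices -/

/-- The random point `X` is `ε`-stationary: `E ‖∇f(X)‖_* ≤ ε`. -/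
def IsEpsStationary {d : ℕ} {Ω : Type*} [MeasurableSpace Ω] (μ : Measure Ω)
    (N : Seminorm ℝ (Vec d)) (f : Vec d → ℝ) (ε : ℝ) (X : Ω → Vec d) : Prop :=
  Integrable (fun ω => dualNorm N (gradient f (X ω))) μ ∧
    ∫ ω, dualNorm N (gradient f (X ω)) ∂μ ≤ ε

/-- The three admissible choices of the stepsize scale `h` (in `η_k = h / (k+1)^{3/4}`), each with
the complexity quantity `Ψ` belonging to it. The argument `ρσ` is the product of `ρ` and `σ`. -/
def IsStepsizeChoice (L₀ L₁ Δ₀ ρσ h Ψ : ℝ) : Prop :=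
  (L₁ = 0 ∧ ∃ η > 0, h = η ∧ Ψ = Δ₀ / η + ρσ + L₀ * η) ∨
  (0 < L₁ ∧ ∃ η > 0, h = η / 17 ∧
    Ψ = Real.exp (L₁ ^ 2 * η ^ 2) * (Δ₀ / η) + ρσ + Real.exp (L₁ ^ 2 * η ^ 2) * L₀ * η) ∨
  (0 < L₁ ∧ h = 1 / (17 * L₁) ∧ Ψ = L₁ * Δ₀ + ρσ + L₀ / L₁)

end

/-! ### Norms on Euclidean space and their duals -/

/-! The statement splits into a deterministic scheduling bound and a stochastic convergence bound.
They meet only in the number `K` of updates and in the fact that an accepted gradient has delay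
below √k. The arrival order `w` is not random, so the accepted computations are fixed in advance and
only the sample values are random.

Time. Consider a stretch of time in which the thresholds are at least `r` and fewer than `r` updates
happen. A computation started inside it has delay below `r`, so each worker loses at most one
gradient, the one begun earlier (`serverLog_count_gain`). One unit per worker for this and the
rounding at the ends are paid for by the factor 1/4 in `blockDuration`
(`IsComputationRate.floor_quarter_le`). Three blocks of `m + 1` updates carry the count from m² + 2m
past (m + 1)² + 2(m + 1), so about 3√K blocks give `K` updates
(`IsArrivalOrder.le_updatesBy_timeBound`).

Convergence. Write q = (k+1)^{1/4}, so that η_k = h/q³. The momentum error m_{k+1} − ∇f(x_k) is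
split into a noise average V_k and a bias B_k. The noises are pairwise orthogonal because each
computation is used at most once, so E‖V_k‖₂² ≤ σ²α_k (`integral_noiseAverage_sq_le`) and the
weighted noise sums to O(hρσ log K). The bias is driven by gradient increments and staleness. The
potential (h/q)‖B‖_* together with an exchange of sums bounds its weighted sum by three times the
increments weighted by h/q (`sum_bias_le`).

Generalized smoothness integrates to exponential growth of L₀ + L₁‖∇f‖_* along a path
(`IsGenSmooth.exp_growth`). Once q ≥ 17L₁h, the L₁ part of all smoothness errors is at most 7/15 of
the descent and is absorbed, while the L₀ part sums to O(h²L₀ log K). The at most (17L₁h)⁴ earlier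
steps are bounded by growth from x₀, where the modulus is controlled by Δ₀ and L₀
(`IsGenSmooth.modulus_le`); this is the source of exp(L₁²η²).

Since Σ 1/q³ ≥ K^{1/4}, if no iterate among the first `K` is ε-stationary, then K^{1/4} ε ≤ CΨ(1 +
log K) (`quarterRoot_mul_le_of_forall_lt`). Inverting this inequality gives the iteration bound. -/

theorem IsNorm.exists_norm_le {d : ℕ} {N : Seminorm ℝ (Vec d)} (hN : IsNorm N) :
    ∃ c : ℝ, 0 < c ∧ ∀ x, ‖x‖ ≤ c * N x := by
  have hcont : Continuous N := by
    have := (N.convexOn).continuousOn_interior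
    simpa [continuousOn_univ] using this
  by_cases hne : (Metric.sphere (0 : Vec d) 1).Nonempty
  · obtain ⟨z, hz, hmin⟩ := (isCompact_sphere (0 : Vec d) 1).exists_isMinOn hne hcont.continuousOn
    have hz1 : ‖z‖ = 1 := by simpa using hz
    have hNz : 0 < N z := by
      refine lt_of_le_of_ne (apply_nonneg N z) fun h0 => ?_
      have := hN z h0.symm
      simp [this] at hz1
    refine ⟨(N z)⁻¹, inv_pos.2 hNz, fun x => ?_⟩
    rcases eq_or_ne x 0 with rfl | hx
    · simp
    have hxn : 0 < ‖x‖ := norm_pos_iff.2 hx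
    have h1 : N z ≤ N (‖x‖⁻¹ • x) := hmin (by simp [norm_smul, hxn.ne'])
    rw [map_smul_eq_mul, norm_inv, norm_norm] at h1
    rw [inv_mul_eq_div, le_div_iff₀ hNz]
    calc ‖x‖ * N z ≤ ‖x‖ * (‖x‖⁻¹ * N x) := by gcongr
      _ = N x := by field_simp
  -- The unit sphere is empty only in dimension 0, where every vector vanishes.
  · refine ⟨1, one_pos, fun x => ?_⟩
    rcases eq_or_ne x 0 with rfl | hx
    · simp
    · exact absurd ⟨‖x‖⁻¹ • x, by simp [norm_smul, (norm_pos_iff.2 hx).ne']⟩ hne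

theorem IsNorm.exists_dualNorm_le {d : ℕ} {N : Seminorm ℝ (Vec d)} (hN : IsNorm N) :
    ∃ c : ℝ, 0 < c ∧ ∀ y u, N u ≤ 1 → ⟪y, u⟫_ℝ ≤ c * ‖y‖ := by
  obtain ⟨c, hc, h⟩ := hN.exists_norm_le
  refine ⟨c, hc, fun y u hu => (real_inner_le_norm y u).trans ?_⟩
  have : ‖u‖ ≤ c := (h u).trans (by nlinarith)
  nlinarith [norm_nonneg y]

theorem IsNorm.bddAbove_inner {d : ℕ} {N : Seminorm ℝ (Vec d)} (hN : IsNorm N) (y : Vec d) :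
    BddAbove ((fun u : Vec d => ⟪y, u⟫_ℝ) '' {u | N u ≤ 1}) := by
  obtain ⟨c, -, h⟩ := hN.exists_dualNorm_le
  refine ⟨c * ‖y‖, ?_⟩
  rintro _ ⟨u, hu, rfl⟩
  exact h y u hu

theorem IsNorm.inner_le_dualNorm {d : ℕ} {N : Seminorm ℝ (Vec d)} (hN : IsNorm N) (y : Vec d)
    {u : Vec d} (hu : N u ≤ 1) : ⟪y, u⟫_ℝ ≤ dualNorm N y :=
  le_csSup (hN.bddAbove_inner y) ⟨u, hu, rfl⟩

theorem dualNorm_le {d : ℕ} {N : Seminorm ℝ (Vec d)} {y : Vec d} {c : ℝ}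
    (h : ∀ u, N u ≤ 1 → ⟪y, u⟫_ℝ ≤ c) : dualNorm N y ≤ c := by
  refine csSup_le ⟨_, 0, by simp, rfl⟩ ?_
  rintro _ ⟨u, hu, rfl⟩
  exact h u hu

theorem IsNorm.inner_le_dualNorm_mul {d : ℕ} {N : Seminorm ℝ (Vec d)} (hN : IsNorm N)
    (y u : Vec d) : ⟪y, u⟫_ℝ ≤ dualNorm N y * N u := by
  rcases eq_or_lt_of_le (apply_nonneg N u) with h | h
  · simp [hN u h.symm]
  · have := hN.inner_le_dualNorm y (u := (N u)⁻¹ • u)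
      (by rw [map_smul_eq_mul, norm_inv, Real.norm_of_nonneg h.le, inv_mul_cancel₀ h.ne'])
    rw [inner_smul_right, inv_mul_le_iff₀ h] at this
    linarith

theorem IsNorm.dualNorm_nonneg {d : ℕ} {N : Seminorm ℝ (Vec d)} (hN : IsNorm N) (y : Vec d) :
    0 ≤ dualNorm N y := by
  simpa using hN.inner_le_dualNorm y (u := 0) (by simp)

/-- The dual norm as a seminorm. -/
noncomputable def dualSeminorm {d : ℕ} (N : Seminorm ℝ (Vec d)) (hN : IsNorm N) :
    Seminorm ℝ (Vec d) :=
  Seminorm.of (dualNorm N)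
    (fun x y => dualNorm_le fun u hu => by
      rw [inner_add_left]
      exact add_le_add (hN.inner_le_dualNorm x hu) (hN.inner_le_dualNorm y hu))
    (by
      have key : ∀ (a : ℝ) (x : Vec d), dualNorm N (a • x) ≤ ‖a‖ * dualNorm N x := by
        intro a x
        refine dualNorm_le fun u hu => ?_
        have := hN.inner_le_dualNorm_mul x (a • u)
        rw [map_smul_eq_mul] at this
        rw [real_inner_smul_left, ← real_inner_smul_right]
        refine this.trans ?_
        have h1 := mul_le_mul_of_nonneg_left hu
          (mul_nonneg (norm_nonneg a) (hN.dualNorm_nonneg x))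
        linarith
      intro a x
      refine le_antisymm (key a x) ?_
      rcases eq_or_ne a 0 with rfl | ha
      · simpa using hN.dualNorm_nonneg _
      · have := key a⁻¹ (a • x)
        rw [inv_smul_smul₀ ha, norm_inv] at this
        rwa [← le_inv_mul_iff₀ (norm_pos_iff.2 ha)])

theorem IsNorm.continuous_dualNorm {d : ℕ} {N : Seminorm ℝ (Vec d)} (hN : IsNorm N) :
    Continuous (dualNorm N) := by
  have h := ((dualSeminorm N hN).convexOn).continuousOn_interior
  rw [interior_univ, continuousOn_univ] at h
  exact h

theorem IsNorm.dualNorm_add_le {d : ℕ} {N : Seminorm ℝ (Vec d)} (hN : IsNorm N) (x y : Vec d) :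
    dualNorm N (x + y) ≤ dualNorm N x + dualNorm N y :=
  map_add_le_add (dualSeminorm N hN) x y

theorem IsNorm.dualNorm_smul {d : ℕ} {N : Seminorm ℝ (Vec d)} (hN : IsNorm N) (a : ℝ)
    (x : Vec d) : dualNorm N (a • x) = |a| * dualNorm N x :=
  map_smul_eq_mul (dualSeminorm N hN) a x

theorem IsNorm.dualNorm_sub_rev {d : ℕ} {N : Seminorm ℝ (Vec d)} (hN : IsNorm N) (x y : Vec d) :
    dualNorm N (x - y) = dualNorm N (y - x) :=
  map_sub_rev (dualSeminorm N hN) x y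

theorem IsNorm.dualNorm_zero {d : ℕ} {N : Seminorm ℝ (Vec d)} (hN : IsNorm N) :
    dualNorm N 0 = 0 :=
  map_zero (dualSeminorm N hN)

theorem IsNorm.dualNorm_le_normConst_mul {d : ℕ} {N : Seminorm ℝ (Vec d)} (hN : IsNorm N)
    (y : Vec d) : dualNorm N y ≤ normConst N * ‖y‖ := by
  rcases eq_or_ne y 0 with rfl | hy
  · simp [hN.dualNorm_zero]
  have hyn : 0 < ‖y‖ := norm_pos_iff.2 hy
  rw [← div_le_iff₀ hyn]
  refine le_ciSup (f := fun z : {z : Vec d // z ≠ 0} => dualNorm N z.1 / ‖z.1‖) ?_ ⟨y, hy⟩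
  obtain ⟨c, -, h⟩ := hN.exists_dualNorm_le
  refine ⟨c, ?_⟩
  rintro _ ⟨z, rfl⟩
  exact (div_le_iff₀ (norm_pos_iff.2 z.2)).2 (dualNorm_le fun u hu => h z.1 u hu)

theorem IsNorm.normConst_nonneg {d : ℕ} {N : Seminorm ℝ (Vec d)} (hN : IsNorm N) :
    0 ≤ normConst N :=
  Real.iSup_nonneg fun _ => div_nonneg (hN.dualNorm_nonneg _) (norm_nonneg _)

theorem IsLMO.apply_le_one {d : ℕ} {N : Seminorm ℝ (Vec d)} {lmo : Vec d → Vec d}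
    (h : IsLMO N lmo) (y : Vec d) : N (lmo y) ≤ 1 := by
  rcases eq_or_ne y 0 with rfl | hy
  · simp [h.1]
  · exact (h.2 y hy).1

theorem IsLMO.inner_apply_le {d : ℕ} {N : Seminorm ℝ (Vec d)} {lmo : Vec d → Vec d}
    (h : IsLMO N lmo) (hN : IsNorm N) (y : Vec d) : ⟪y, lmo y⟫_ℝ ≤ -dualNorm N y := by
  rcases eq_or_ne y 0 with rfl | hy
  · simp [h.1, hN.dualNorm_zero]
  · rw [le_neg]
    refine dualNorm_le fun u hu => ?_
    have := (h.2 y hy).2 (-u) (by simpa using hu)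
    rw [inner_neg_right] at this
    linarith

/-- Descent of the linear model along the oracle direction of a perturbed gradient. -/
theorem IsLMO.inner_apply_perturbed_le {d : ℕ} {N : Seminorm ℝ (Vec d)} {lmo : Vec d → Vec d}
    (h : IsLMO N lmo) (hN : IsNorm N) (g m : Vec d) :
    ⟪g, lmo m⟫_ℝ ≤ -dualNorm N g + 2 * dualNorm N (m - g) := by
  have h1 := h.inner_apply_le hN m
  have h2 := hN.inner_le_dualNorm (g - m) (h.apply_le_one m)
  have h3 := hN.dualNorm_add_le m (g - m)
  rw [inner_sub_left] at h2
  rw [add_sub_cancel, hN.dualNorm_sub_rev g m] at h3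
  rw [hN.dualNorm_sub_rev g m] at h2
  linarith

/-! ### Generalized smoothness -/

/-- The local smoothness modulus `L₀ + L₁ ‖∇f(x)‖_*`. -/
noncomputable def modulus {d : ℕ} (N : Seminorm ℝ (Vec d)) (f : Vec d → ℝ) (L₀ L₁ : ℝ)
    (x : Vec d) : ℝ := L₀ + L₁ * dualNorm N (gradient f x)

theorem modulus_nonneg {d : ℕ} {N : Seminorm ℝ (Vec d)} (hN : IsNorm N) (f : Vec d → ℝ)
    {L₀ L₁ : ℝ} (h₀ : 0 ≤ L₀) (h₁ : 0 ≤ L₁) (x : Vec d) : 0 ≤ modulus N f L₀ L₁ x :=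
  add_nonneg h₀ (mul_nonneg h₁ (hN.dualNorm_nonneg _))

theorem one_le_one_sub_mul_exp_two_mul {t : ℝ} (h0 : 0 ≤ t) (h1 : t ≤ 1 / 2) :
    1 ≤ (1 - t) * Real.exp (2 * t) := by
  nlinarith [Real.add_one_le_exp (2 * t)]

/-- A bootstrap: the supremum M of the modulus over the segment is finite by hypothesis and
satisfies M ≤ modulus(x) + L₁rM, where r is the length of the segment. For L₁r ≤ 1/2 this can be
solved for M, and 1/(1 − t) ≤ e^{2t} puts the result in a form that composes along a path. -/
theorem IsGenSmooth.short_step {d : ℕ} {N : Seminorm ℝ (Vec d)} (hN : IsNorm N) {f : Vec d → ℝ}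
    {L₀ L₁ : ℝ} (h₁ : 0 ≤ L₁) (h₀ : 0 ≤ L₀) (hf : IsGenSmooth N f L₀ L₁) (x y : Vec d)
    (hr : L₁ * N (y - x) ≤ 1 / 2) :
    modulus N f L₀ L₁ y ≤ modulus N f L₀ L₁ x * Real.exp (2 * (L₁ * N (y - x))) ∧
    dualNorm N (gradient f y - gradient f x) ≤
      modulus N f L₀ L₁ x * N (y - x) * Real.exp (2 * (L₁ * N (y - x))) := by
  set r := N (y - x) with hrdef
  have hr0 : 0 ≤ r := apply_nonneg N _
  set M := ⨆ θ : Set.Icc (0 : ℝ) 1, modulus N f L₀ L₁ (θ.1 • y + (1 - θ.1) • x) with hM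
  have hbdd : BddAbove (Set.range fun θ : Set.Icc (0 : ℝ) 1 =>
    modulus N f L₀ L₁ (θ.1 • y + (1 - θ.1) • x)) := (hf y x).1
  have hM0 : 0 ≤ M := Real.iSup_nonneg fun θ => modulus_nonneg hN f h₀ h₁ _
  have hseg : ∀ t : Set.Icc (0 : ℝ) 1,
      dualNorm N (gradient f (t.1 • y + (1 - t.1) • x) - gradient f x) ≤ M * r := by
    intro t
    have h1 := (hf (t.1 • y + (1 - t.1) • x) x).2
    have hz : t.1 • y + (1 - t.1) • x - x = t.1 • (y - x) := by module
    rw [hz, map_smul_eq_mul, Real.norm_of_nonneg t.2.1] at h1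
    refine h1.trans ?_
    have hle : (⨆ θ : Set.Icc (0 : ℝ) 1,
        (L₀ + L₁ * dualNorm N (gradient f (θ.1 • (t.1 • y + (1 - t.1) • x) + (1 - θ.1) • x)))) ≤ M := by
      -- Subsegments issuing from `x` lie in the full segment, so their suprema are also at most
      -- `M`.
      refine ciSup_le fun θ => ?_
      have hm : θ.1 * t.1 ∈ Set.Icc (0 : ℝ) 1 :=
        ⟨mul_nonneg θ.2.1 t.2.1, mul_le_one₀ θ.2.2 t.2.1 t.2.2⟩
      have := le_ciSup hbdd ⟨θ.1 * t.1, hm⟩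
      have he : θ.1 • (t.1 • y + (1 - t.1) • x) + (1 - θ.1) • x
        = (θ.1 * t.1) • y + (1 - θ.1 * t.1) • x := by module
      rw [he]
      exact this
    have ht : t.1 * r ≤ r := by nlinarith [t.2.2]
    exact mul_le_mul hle ht (mul_nonneg t.2.1 hr0) hM0
  have hMle : M ≤ modulus N f L₀ L₁ x + L₁ * r * M := by
    refine ciSup_le fun t => ?_
    have h1 := hN.dualNorm_add_le (gradient f x)
      (gradient f (t.1 • y + (1 - t.1) • x) - gradient f x)
    rw [add_sub_cancel] at h1
    have h2 := mul_le_mul_of_nonneg_left (h1.trans (add_le_add_right (hseg t) _)) h₁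
    simp only [modulus]
    linarith
  have hexp := one_le_one_sub_mul_exp_two_mul (mul_nonneg h₁ hr0) hr
  have hMexp : M ≤ modulus N f L₀ L₁ x * Real.exp (2 * (L₁ * r)) := by
    have h1 : (1 - L₁ * r) * M ≤ modulus N f L₀ L₁ x := by linarith
    calc M ≤ ((1 - L₁ * r) * Real.exp (2 * (L₁ * r))) * M := le_mul_of_one_le_left hM0 hexp
      _ = ((1 - L₁ * r) * M) * Real.exp (2 * (L₁ * r)) := by ring
      _ ≤ _ := by gcongr
  constructor
  · refine le_trans ?_ hMexp
    have := le_ciSup hbdd ⟨1, by simp⟩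
    simpa using this
  · have := hseg ⟨1, by simp⟩
    simp only [one_smul, sub_self, zero_smul, add_zero] at this
    refine this.trans ?_
    nlinarith

/-- The length restriction of `short_step` is removed by bisection: exponential factors multiply and
lengths add, so the bound for the two halves gives the same bound for the whole segment. The
induction is on the number of bisections needed. -/
theorem IsGenSmooth.exp_growth {d : ℕ} {N : Seminorm ℝ (Vec d)} (hN : IsNorm N) {f : Vec d → ℝ}
    {L₀ L₁ : ℝ} (h₁ : 0 ≤ L₁) (h₀ : 0 ≤ L₀) (hf : IsGenSmooth N f L₀ L₁) (x y : Vec d) :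
    modulus N f L₀ L₁ y ≤ modulus N f L₀ L₁ x * Real.exp (2 * (L₁ * N (y - x))) ∧
    dualNorm N (gradient f y - gradient f x) ≤
      modulus N f L₀ L₁ x * N (y - x) * Real.exp (2 * (L₁ * N (y - x))) := by
  obtain ⟨m, hm⟩ : ∃ m : ℕ, L₁ * N (y - x) ≤ 2 ^ m / 2 := by
    obtain ⟨m, hm⟩ := pow_unbounded_of_one_lt (2 * (L₁ * N (y - x))) (one_lt_two (α := ℝ))
    exact ⟨m, by linarith⟩
  induction m generalizing x y with
  | zero => exact hf.short_step hN h₁ h₀ x y (by simpa using hm)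
  | succ m ih =>
    set z : Vec d := (1 / 2 : ℝ) • (x + y) with hz
    set r := N (y - x) with hr
    have hr0 : 0 ≤ r := apply_nonneg N _
    have e1 : N (z - x) = r / 2 := by
      rw [show z - x = (1 / 2 : ℝ) • (y - x) by rw [hz]; module, map_smul_eq_mul,
        Real.norm_of_nonneg (by norm_num)]; ring
    have e2 : N (y - z) = r / 2 := by
      rw [show y - z = (1 / 2 : ℝ) • (y - x) by rw [hz]; module, map_smul_eq_mul,
        Real.norm_of_nonneg (by norm_num)]; ring
    have hhalf : L₁ * (r / 2) ≤ 2 ^ m / 2 := by rw [pow_succ] at hm; linarith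
    obtain ⟨a1, a2⟩ := ih x z (by rwa [e1])
    obtain ⟨b1, b2⟩ := ih z y (by rwa [e2])
    rw [e1] at a1 a2
    rw [e2] at b1 b2
    set E := Real.exp (2 * (L₁ * (r / 2))) with hE
    have hEE : Real.exp (2 * (L₁ * r)) = E * E := by rw [hE, ← Real.exp_add]; congr 1; ring
    have hE1 : 1 ≤ E := Real.one_le_exp (by positivity)
    have ha := modulus_nonneg hN f h₀ h₁ x
    rw [hEE]
    constructor
    · calc _ ≤ _ := b1
        _ ≤ (modulus N f L₀ L₁ x * E) * E := by gcongr
        _ = _ := by ring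
    · have h3 := hN.dualNorm_add_le (gradient f y - gradient f z) (gradient f z - gradient f x)
      rw [sub_add_sub_cancel] at h3
      have h4 : modulus N f L₀ L₁ z * (r / 2) * E ≤ (modulus N f L₀ L₁ x * E) * (r / 2) * E := by
        gcongr
      have h5 : modulus N f L₀ L₁ x * (r / 2) * E ≤ modulus N f L₀ L₁ x * (r / 2) * (E * E) := by
        gcongr
        nlinarith
      calc _ ≤ _ := h3
        _ ≤ (modulus N f L₀ L₁ x * E) * (r / 2) * E + modulus N f L₀ L₁ x * (r / 2) * (E * E) := by
          linarith
        _ = _ := by ring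

/-- The mean value theorem is applied instead of integrating along the segment. This loses the usual
factor 1/2, which only affects constants. -/
theorem IsGenSmooth.descent {d : ℕ} {N : Seminorm ℝ (Vec d)} (hN : IsNorm N) {f : Vec d → ℝ}
    {L₀ L₁ : ℝ} (h₁ : 0 ≤ L₁) (h₀ : 0 ≤ L₀) (hf : IsGenSmooth N f L₀ L₁)
    (hd : Differentiable ℝ f) (x y : Vec d) :
    f y ≤ f x + ⟪gradient f x, y - x⟫_ℝ +
      modulus N f L₀ L₁ x * N (y - x) ^ 2 * Real.exp (2 * (L₁ * N (y - x))) := by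
  obtain ⟨z, hz, hzf⟩ := domain_mvt (f := f) (s := Set.univ) (x := x) (y := y)
    (f' := fun z => fderiv ℝ f z) (fun z _ => (hd z).hasFDerivAt.hasFDerivWithinAt)
    convex_univ (Set.mem_univ _) (Set.mem_univ _)
  have hgz : fderiv ℝ f z (y - x) = ⟪gradient f z, y - x⟫_ℝ := by
    rw [gradient, InnerProductSpace.toDual_symm_apply]
  obtain ⟨a, b, ha, hb, hab, rfl⟩ := hz
  set r := N (y - x) with hr
  have hr0 : 0 ≤ r := apply_nonneg N _
  have hzx : a • x + b • y - x = b • (y - x) := by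
    rw [show a = 1 - b by linarith]; module
  have hNz : N (a • x + b • y - x) = b * r := by
    rw [hzx, map_smul_eq_mul, Real.norm_of_nonneg hb]
  have hbr : b * r ≤ r := by nlinarith
  have h2 := (hf.exp_growth hN h₁ h₀ x (a • x + b • y)).2
  rw [hNz] at h2
  have ham := modulus_nonneg hN f h₀ h₁ x
  have h3 : dualNorm N (gradient f (a • x + b • y) - gradient f x) ≤
      modulus N f L₀ L₁ x * r * Real.exp (2 * (L₁ * r)) := h2.trans (by gcongr)
  have h4 := hN.inner_le_dualNorm_mul (gradient f (a • x + b • y) - gradient f x) (y - x)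
  rw [inner_sub_left, ← hr] at h4
  have h5 := mul_le_mul_of_nonneg_right h3 hr0
  rw [hgz] at hzf
  nlinarith

/-- A trial step of length 1/(8L₁) along the exact oracle direction cannot take `f` below `fstar`,
so a large gradient forces a large gap f(x) − f*. -/
theorem IsGenSmooth.modulus_le {d : ℕ} {N : Seminorm ℝ (Vec d)} (hN : IsNorm N) {f : Vec d → ℝ}
    {L₀ L₁ : ℝ} (h₁ : 0 ≤ L₁) (h₀ : 0 ≤ L₀) (hf : IsGenSmooth N f L₀ L₁)
    (hd : Differentiable ℝ f) {lmo : Vec d → Vec d} (hlmo : IsLMO N lmo) {fstar : ℝ}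
    (hstar : ∀ x, fstar ≤ f x) (x : Vec d) :
    modulus N f L₀ L₁ x ≤ 10 * L₁ ^ 2 * (f x - fstar) + 2 * L₀ := by
  rcases eq_or_lt_of_le h₁ with h | h
  · rw [modulus, ← h]; simp; linarith
  set r : ℝ := 1 / (8 * L₁) with hr
  have hr0 : 0 < r := by positivity
  set G := dualNorm N (gradient f x) with hG
  have hG0 : 0 ≤ G := hN.dualNorm_nonneg _
  have h2 := hf.descent hN h₁ h₀ hd x (x + r • lmo (gradient f x))
  rw [add_sub_cancel_left, real_inner_smul_right, map_smul_eq_mul, Real.norm_of_nonneg hr0.le] at h2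
  have h3 := hlmo.inner_apply_le hN (gradient f x)
  have h4 := hlmo.apply_le_one (gradient f x)
  have h4' := apply_nonneg N (lmo (gradient f x))
  have hLr : L₁ * r = 1 / 8 := by rw [hr]; field_simp
  have h5 : Real.exp (2 * (L₁ * (r * N (lmo (gradient f x))))) ≤ 4 / 3 := by
    have : Real.exp (2 * (L₁ * (r * N (lmo (gradient f x))))) ≤ Real.exp (1 / 4) := by
      apply Real.exp_le_exp.2
      rw [← mul_assoc L₁, hLr]; linarith
    refine this.trans ?_
    have := Real.one_sub_le_exp_neg (1 / 4)
    rw [Real.exp_neg] at this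
    have hp := Real.exp_pos (1 / 4)
    rw [← one_div, le_div_iff₀ hp] at this
    linarith
  have h6 : (r * N (lmo (gradient f x))) ^ 2 ≤ r ^ 2 := by
    apply pow_le_pow_left₀ (by positivity)
    nlinarith
  have ham := modulus_nonneg hN f h₀ h₁ x
  have h7 : modulus N f L₀ L₁ x * (r * N (lmo (gradient f x))) ^ 2 *
      Real.exp (2 * (L₁ * (r * N (lmo (gradient f x))))) ≤ modulus N f L₀ L₁ x * r ^ 2 * (4 / 3) := by
    gcongr
  have h8 := hstar (x + r • lmo (gradient f x))
  have h9 : r * ⟪gradient f x, lmo (gradient f x)⟫_ℝ ≤ r * (-G) := by gcongr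
  have h10 : r * G ≤ (f x - fstar) + (L₀ + L₁ * G) * r ^ 2 * (4 / 3) := by
    rw [modulus] at h7 h2; linarith
  have h11 : L₁ ^ 2 * (r * G) ≤ L₁ ^ 2 * ((f x - fstar) + (L₀ + L₁ * G) * r ^ 2 * (4 / 3)) := by
    gcongr
  have e1 : L₁ ^ 2 * (r * G) = L₁ * G / 8 := by
    rw [show L₁ ^ 2 * (r * G) = (L₁ * r) * (L₁ * G) by ring, hLr]; ring
  have e2 : L₁ ^ 2 * ((f x - fstar) + (L₀ + L₁ * G) * r ^ 2 * (4 / 3))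
      = L₁ ^ 2 * (f x - fstar) + (L₀ + L₁ * G) * (4 / 3) / 64 := by
    rw [show L₁ ^ 2 * ((f x - fstar) + (L₀ + L₁ * G) * r ^ 2 * (4 / 3))
      = L₁ ^ 2 * (f x - fstar) + (L₀ + L₁ * G) * (4 / 3) * (L₁ * r) ^ 2 by ring, hLr]; ring
  rw [e1, e2] at h11
  have := hstar x
  rw [modulus]
  have h12 : 0 ≤ L₁ ^ 2 * (f x - fstar) := mul_nonneg (sq_nonneg _) (by linarith)
  linarith

theorem measurable_gradient {d : ℕ} (f : Vec d → ℝ) : Measurable (gradient f) :=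
  (InnerProductSpace.toDual ℝ (Vec d)).symm.continuous.measurable.comp (measurable_fderiv ℝ f)

/-! ### Bookkeeping of the server -/

theorem serverLog_succ_count {n : ℕ} (R : ℕ → ℝ) (w : ℕ → Fin n) (l : ℕ) :
    (serverLog R w (l + 1)).count =
      if ((serverLog R w l).count : ℝ) - (serverLog R w l).origin (w l) <
        R (serverLog R w l).count then (serverLog R w l).count + 1
      else (serverLog R w l).count := rfl

theorem serverLog_succ_origin {n : ℕ} (R : ℕ → ℝ) (w : ℕ → Fin n) (l : ℕ) :
    (serverLog R w (l + 1)).origin =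
      Function.update (serverLog R w l).origin (w l) (serverLog R w (l + 1)).count := rfl

theorem serverLog_succ_origin_self {n : ℕ} (R : ℕ → ℝ) (w : ℕ → Fin n) (l : ℕ) :
    (serverLog R w (l + 1)).origin (w l) = (serverLog R w (l + 1)).count := by
  rw [serverLog_succ_origin, Function.update_self]

theorem serverLog_count_mono {n : ℕ} (R : ℕ → ℝ) (w : ℕ → Fin n) :
    Monotone fun l => (serverLog R w l).count := by
  refine monotone_nat_of_le_succ fun l => ?_
  rw [serverLog_succ_count]
  split_ifs <;> omega

theorem serverLog_succ_count_le {n : ℕ} (R : ℕ → ℝ) (w : ℕ → Fin n) (l : ℕ) :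
    (serverLog R w (l + 1)).count ≤ (serverLog R w l).count + 1 := by
  rw [serverLog_succ_count]
  split_ifs <;> omega

theorem serverLog_origin_le_count {n : ℕ} (R : ℕ → ℝ) (w : ℕ → Fin n) (l : ℕ) (i : Fin n) :
    (serverLog R w l).origin i ≤ (serverLog R w l).count := by
  induction l with
  | zero => exact le_rfl
  | succ l ih =>
    rcases eq_or_ne i (w l) with rfl | h
    · exact (serverLog_succ_origin_self R w l).le
    · rw [serverLog_succ_origin, Function.update_of_ne h]
      exact ih.trans (serverLog_count_mono R w (Nat.le_succ l))

theorem serverLog_origin_mono {n : ℕ} (R : ℕ → ℝ) (w : ℕ → Fin n) (i : Fin n) :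
    Monotone fun l => (serverLog R w l).origin i := by
  refine monotone_nat_of_le_succ fun l => ?_
  rcases eq_or_ne i (w l) with rfl | h
  · rw [serverLog_succ_origin_self]
    exact (serverLog_origin_le_count R w l _).trans (serverLog_count_mono R w (Nat.le_succ l))
  · rw [serverLog_succ_origin, Function.update_of_ne h]

/-- If the count froze, a worker arriving for the second time would have delay 0 and be accepted.
Hence all later arrivals would come from distinct workers, of which there are finitely many. -/
theorem exists_serverLog_count_lt {n : ℕ} {R : ℕ → ℝ} (hR : ∀ k, 0 < R k) (w : ℕ → Fin n) (l : ℕ) :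
    ∃ l', (serverLog R w l).count < (serverLog R w l').count := by
  by_contra! hcon
  have hconst : ∀ j, (serverLog R w (l + j)).count = (serverLog R w l).count := fun j =>
    le_antisymm (hcon _) (serverLog_count_mono R w (Nat.le_add_right l j))
  refine not_injective_infinite_finite (fun j => w (l + j)) ?_
  have key : ∀ a b, a < b → w (l + a) ≠ w (l + b) := by
    intro a b hab hw
    have h1 : (serverLog R w (l + a + 1)).origin (w (l + a)) = (serverLog R w l).count := by
      rw [serverLog_succ_origin_self, ← hconst (a + 1), add_assoc]
    have h2 := serverLog_origin_mono R w (w (l + a)) (show l + a + 1 ≤ l + b by omega)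
    simp only [h1] at h2
    have h3 := serverLog_origin_le_count R w (l + b) (w (l + a))
    rw [hconst b] at h3
    have h4 := serverLog_succ_count R w (l + b)
    rw [← hw, le_antisymm h3 h2, hconst b, sub_self, if_pos (hR _), add_assoc, hconst (b + 1)] at h4
    omega
  intro a b hab
  rcases lt_trichotomy a b with h | h | h
  · exact absurd hab (key a b h)
  · exact h
  · exact absurd hab.symm (key b a h)

theorem exists_lt_serverLog_count {n : ℕ} {R : ℕ → ℝ} (hR : ∀ k, 0 < R k) (w : ℕ → Fin n) (k : ℕ) :
    ∃ l, k < (serverLog R w (l + 1)).count := by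
  induction k with
  | zero =>
    obtain ⟨l', hl'⟩ := exists_serverLog_count_lt hR w 0
    exact ⟨l', lt_of_lt_of_le (Nat.zero_lt_of_lt hl') (serverLog_count_mono R w (Nat.le_succ l'))⟩
  | succ k ih =>
    obtain ⟨l, hl⟩ := ih
    obtain ⟨l', hl'⟩ := exists_serverLog_count_lt hR w (l + 1)
    have := serverLog_count_mono R w (Nat.le_succ l')
    simp only at this
    exact ⟨l', by rw [Nat.succ_eq_add_one] at this; omega⟩

theorem serverLog_acceptedArrival {n : ℕ} {R : ℕ → ℝ} (hR : ∀ k, 0 < R k) (w : ℕ → Fin n) (k : ℕ) :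
    (serverLog R w (acceptedArrival R w k)).count = k ∧
      (serverLog R w (acceptedArrival R w k + 1)).count = k + 1 ∧
      (k : ℝ) - acceptedOrigin R w k < R k := by
  have hmem : k < (serverLog R w (acceptedArrival R w k + 1)).count :=
    Nat.sInf_mem (exists_lt_serverLog_count hR w k)
  have hle : (serverLog R w (acceptedArrival R w k)).count ≤ k := by
    by_contra! hlt
    obtain ⟨a, ha⟩ : ∃ a, acceptedArrival R w k = a + 1 := by
      refine Nat.exists_eq_succ_of_ne_zero fun h0 => ?_
      rw [h0] at hlt
      exact Nat.not_lt_zero _ hlt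
    rw [ha] at hlt
    have : acceptedArrival R w k ≤ a := Nat.sInf_le hlt
    omega
  have hs := serverLog_succ_count_le R w (acceptedArrival R w k)
  have hc : (serverLog R w (acceptedArrival R w k)).count = k := by omega
  refine ⟨hc, by omega, ?_⟩
  have h := serverLog_succ_count R w (acceptedArrival R w k)
  rw [hc] at h
  by_contra hcon
  rw [if_neg (by exact hcon)] at h
  omega

theorem acceptedOrigin_le {n : ℕ} {R : ℕ → ℝ} (hR : ∀ k, 0 < R k) (w : ℕ → Fin n) (k : ℕ) :
    acceptedOrigin R w k ≤ k := by
  have h := serverLog_origin_le_count R w (acceptedArrival R w k) (acceptedWorker R w k)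
  rwa [(serverLog_acceptedArrival hR w k).1] at h

/-- Every computation is used in at most one update. -/
theorem accepted_ne_of_lt {n : ℕ} {R : ℕ → ℝ} (hR : ∀ k, 0 < R k) (w : ℕ → Fin n) {j k : ℕ}
    (hjk : j < k) : (acceptedOrigin R w j, acceptedWorker R w j) ≠
      (acceptedOrigin R w k, acceptedWorker R w k) := by
  intro h
  obtain ⟨ho, hi⟩ := Prod.mk.inj h
  obtain ⟨-, hj, -⟩ := serverLog_acceptedArrival hR w j
  obtain ⟨hk, -, -⟩ := serverLog_acceptedArrival hR w k
  have hl : acceptedArrival R w j + 1 ≤ acceptedArrival R w k := by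
    by_contra! hlt
    have h1 := serverLog_count_mono R w (Nat.lt_succ_iff.1 hlt)
    have h2 := serverLog_count_mono R w (Nat.le_succ (acceptedArrival R w j))
    simp only [hk] at h1
    obtain ⟨hj', -, -⟩ := serverLog_acceptedArrival hR w j
    omega
  -- After update `j` the worker restarts at index `j + 1`, beyond the origin of the gradient just
  -- used, and its origin never decreases afterwards.
  have h1 := serverLog_origin_mono R w (acceptedWorker R w j) hl
  have h2 := serverLog_succ_origin_self R w (acceptedArrival R w j)
  rw [hj] at h2
  have h3 := acceptedOrigin_le hR w j
  simp only at h1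
  rw [acceptedWorker, h2] at h1
  have h4 : (serverLog R w (acceptedArrival R w k)).origin (w (acceptedArrival R w j)) =
      acceptedOrigin R w k := by
    rw [acceptedOrigin, ← hi, acceptedWorker]
  omega

theorem received_succ {n : ℕ} (w : ℕ → Fin n) (l : ℕ) (i : Fin n) :
    received w (l + 1) i = received w l i + if w l = i then 1 else 0 := by
  rw [received, received, Finset.range_add_one, Finset.filter_insert]
  split_ifs with h
  · rw [Finset.card_insert_of_notMem (by simp)]
  · rfl

theorem sum_received {n : ℕ} (w : ℕ → Fin n) (l : ℕ) : ∑ i, received w l i = l := by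
  induction l with
  | zero => simp [received]
  | succ l ih => simp [received_succ, Finset.sum_add_distrib, ih]

/-- While fewer than `R` updates are made, every worker can have at most one gradient discarded:
the one whose computation was started before. -/
theorem serverLog_count_gain {n : ℕ} {R : ℕ → ℝ} (w : ℕ → Fin n) {k₀ r l₀ : ℕ}
    (hR : ∀ k, k₀ ≤ k → ∀ δ < r, (δ : ℝ) < R k) (hk₀ : k₀ ≤ (serverLog R w l₀).count) (j : ℕ)
    (hlt : (serverLog R w (l₀ + j)).count < k₀ + r) :
    (serverLog R w l₀).count + ∑ i, (received w (l₀ + j) i - received w l₀ i - 1) ≤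
      (serverLog R w (l₀ + j)).count ∧
    ∀ i, received w l₀ i < received w (l₀ + j) i → k₀ ≤ (serverLog R w (l₀ + j)).origin i := by
  induction j with
  | zero => simp
  | succ j ih =>
    have hmono := serverLog_count_mono R w (Nat.le_succ (l₀ + j))
    have hmono₀ := serverLog_count_mono R w (Nat.le_add_right l₀ j)
    simp only [Nat.succ_eq_add_one, add_assoc] at hmono hmono₀
    obtain ⟨ih1, ih2⟩ := ih (by omega)
    have hor := serverLog_succ_origin R w (l₀ + j)
    have hors := serverLog_succ_origin_self R w (l₀ + j)
    have hcs := serverLog_succ_count R w (l₀ + j)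
    rw [add_assoc] at hor hors hcs
    constructor
    -- A worker heard from since `l₀` restarted at an index at least `k₀`, so its delay is below `r`
    -- and the gradient is accepted. A first report since `l₀` may be discarded, but truncated
    -- subtraction keeps its summand at 0.
    · by_cases hrec : received w l₀ (w (l₀ + j)) < received w (l₀ + j) (w (l₀ + j))
      · have h1 := ih2 _ hrec
        rw [if_pos] at hcs
        · have hsum : ∑ i, (received w (l₀ + (j + 1)) i - received w l₀ i - 1) ≤
              ∑ i, (received w (l₀ + j) i - received w l₀ i - 1) + 1 := by
            have : ∀ i, received w (l₀ + (j + 1)) i - received w l₀ i - 1 ≤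
                (received w (l₀ + j) i - received w l₀ i - 1) + if w (l₀ + j) = i then 1 else 0 := by
              intro i
              rw [← add_assoc, received_succ]
              split_ifs <;> omega
            refine (Finset.sum_le_sum fun i _ => this i).trans ?_
            simp [Finset.sum_add_distrib]
          omega
        · rw [← Nat.cast_sub (serverLog_origin_le_count R w (l₀ + j) _)]
          exact hR _ (by omega) _ (by omega)
      · have hsum : ∑ i, (received w (l₀ + (j + 1)) i - received w l₀ i - 1) ≤
              ∑ i, (received w (l₀ + j) i - received w l₀ i - 1) := by
          refine Finset.sum_le_sum fun i _ => ?_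
          rw [← add_assoc, received_succ]
          split_ifs with h
          · subst h; omega
          · omega
        omega
    · intro i hi
      rcases eq_or_ne i (w (l₀ + j)) with rfl | h
      · rw [hors]; omega
      · rw [hor, Function.update_of_ne h]
        refine ih2 i ?_
        rw [← add_assoc, received_succ, if_neg h.symm] at hi
        simpa using hi

/-! ### Completion times -/

theorem IsComputationRate.intervalIntegrable {p : ℝ → ℝ} (hp : IsComputationRate p) {a b : ℝ}
    (ha : 0 ≤ a) (hb : 0 ≤ b) : IntervalIntegrable p volume a b :=
  (hp.integrable a ha).symm.trans (hp.integrable b hb)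

theorem IsComputationRate.continuous_integral {p : ℝ → ℝ} (hp : IsComputationRate p) {a : ℝ}
    (ha : 0 ≤ a) : Continuous fun t : ℝ≥0 => ∫ s in a..a + t, p s := by
  rw [continuous_iff_continuousAt]
  intro t
  have hb : 0 ≤ a + t + 1 := by positivity
  have h := intervalIntegral.continuousOn_primitive_interval' (hp.integrable (a + t + 1) hb)
    (a := a) (by rw [Set.uIcc_of_le hb]; constructor <;> linarith [t.2, NNReal.coe_nonneg t])
  rw [Set.uIcc_of_le hb] at h
  have h2 := h (a + t) (by constructor <;> linarith [NNReal.coe_nonneg t])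
  have h3 : Filter.Tendsto (fun s : ℝ≥0 => a + (s : ℝ)) (nhds t)
      (nhdsWithin (a + t) (Set.Icc 0 (a + t + 1))) := by
    refine tendsto_nhdsWithin_iff.2 ⟨(by fun_prop : Continuous fun s : ℝ≥0 => a + (s : ℝ)).tendsto t, ?_⟩
    have h4 : ∀ᶠ s : ℝ≥0 in nhds t, s < t + 1 := Iio_mem_nhds (by simp)
    filter_upwards [h4] with s hs
    have : (s : ℝ) < t + 1 := by exact_mod_cast hs
    constructor <;> linarith [NNReal.coe_nonneg s]
  exact h2.tendsto.comp h3

theorem IsComputationRate.integral_nonneg {p : ℝ → ℝ} (hp : IsComputationRate p) {a b : ℝ}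
    (ha : 0 ≤ a) (hab : a ≤ b) : 0 ≤ ∫ s in a..b, p s :=
  intervalIntegral.integral_nonneg hab fun s hs => hp.nonneg s (ha.trans hs.1)

theorem IsComputationRate.integral_add {p : ℝ → ℝ} (hp : IsComputationRate p) {a b : ℝ}
    (ha : 0 ≤ a) (hb : 0 ≤ b) :
    (∫ s in 0..a, p s) + ∫ s in a..b, p s = ∫ s in 0..b, p s :=
  intervalIntegral.integral_add_adjacent_intervals (hp.integrable a ha)
    (hp.intervalIntegrable ha hb)

theorem IsComputationRate.numGradients_mono {p : ℝ → ℝ} (hp : IsComputationRate p) {a b : ℝ}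
    (ha : 0 ≤ a) (hab : a ≤ b) : numGradients p 0 a ≤ numGradients p 0 b := by
  refine Nat.floor_mono ?_
  rw [← hp.integral_add ha (ha.trans hab)]
  linarith [hp.integral_nonneg ha hab]

theorem eventually_floor_le {X : Type*} [TopologicalSpace X] {φ : X → ℝ} (hφ : Continuous φ)
    (t : X) : ∀ᶠ s in nhds t, ⌊φ s⌋₊ ≤ ⌊φ t⌋₊ := by
  have : ∀ᶠ s in nhds t, φ s < (⌊φ t⌋₊ + 1 : ℕ) :=
    hφ.continuousAt.eventually_lt continuousAt_const (by exact_mod_cast Nat.lt_floor_add_one (φ t))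
  filter_upwards [this] with s hs
  exact Nat.lt_succ_iff.1 ((Nat.floor_lt' (Nat.succ_ne_zero _)).2 hs)

/-- Upper semicontinuity makes the superlevel set closed, so the first time is attained. It serves
both completion times and block durations. -/
theorem exists_eq_iInf_of_upperSemicontinuous {φ : ℝ≥0 → ℕ}
    (husc : ∀ t, ∀ᶠ s in nhds t, φ s ≤ φ t) {r : ℕ}
    (h : ⨅ (t : ℝ≥0) (_ : r ≤ φ t), (t : ℝ≥0∞) ≠ ⊤) :
    ∃ t₀, r ≤ φ t₀ ∧ ⨅ (t : ℝ≥0) (_ : r ≤ φ t), (t : ℝ≥0∞) = t₀ := by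
  have hcl : IsClosed {t | r ≤ φ t} := by
    rw [← isOpen_compl_iff, isOpen_iff_eventually]
    intro t ht
    filter_upwards [husc t] with s hs
    simp only [Set.mem_compl_iff, Set.mem_ofPred_eq, not_le] at ht ⊢
    omega
  have hne : {t | r ≤ φ t}.Nonempty := by
    by_contra hemp
    refine h ?_
    rw [Set.not_nonempty_iff_eq_empty] at hemp
    refine iInf₂_eq_top.2 fun t ht => ?_
    have : t ∈ {t | r ≤ φ t} := ht
    simp [hemp] at this
  have hmem := hcl.csInf_mem hne (OrderBot.bddBelow _)
  refine ⟨_, hmem, le_antisymm (iInf₂_le _ hmem) (le_iInf₂ fun t ht => ?_)⟩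
  exact ENNReal.coe_le_coe.2 (csInf_le (OrderBot.bddBelow _) ht)

theorem IsComputationRate.completionTime_le_iff {p : ℝ → ℝ} (hp : IsComputationRate p) {j : ℕ}
    {t : ℝ≥0} : completionTime p j ≤ t ↔ j ≤ numGradients p 0 t := by
  constructor
  · intro h
    have husc : ∀ t : ℝ≥0, ∀ᶠ s : ℝ≥0 in nhds t, numGradients p 0 s ≤ numGradients p 0 t := by
      have := hp.continuous_integral le_rfl
      simp only [zero_add] at this
      exact eventually_floor_le this
    obtain ⟨t₀, h1, h2⟩ := exists_eq_iInf_of_upperSemicontinuous (r := j) husc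
      (ne_top_of_le_ne_top ENNReal.coe_ne_top h)
    rw [completionTime, h2] at h
    exact h1.trans (hp.numGradients_mono t₀.2 (by exact_mod_cast h))
  · exact fun h => iInf₂_le t h

/-- The total number of gradients the workers complete in `[0, t]`. -/
noncomputable def numArrivals {n : ℕ} (p : Fin n → ℝ → ℝ) (t : ℝ≥0) : ℕ :=
  ∑ i, numGradients (p i) 0 t

theorem IsArrivalOrder.received_le {n : ℕ} {p : Fin n → ℝ → ℝ} (hp : ∀ i, IsComputationRate (p i))
    {w : ℕ → Fin n} (hw : IsArrivalOrder p w) (t : ℝ≥0) (l : ℕ) (hl : l ≤ numArrivals p t) :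
    ∀ i, received w l i ≤ numGradients (p i) 0 t := by
  induction l with
  | zero => simp [received]
  | succ l ih =>
    have ih' := ih (by omega)
    -- Pigeonhole: some worker has finished by `t` a gradient not yet received, and the next arrival
    -- is no later than that one.
    have hex : ∃ i, received w l i < numGradients (p i) 0 t := by
      by_contra! hcon
      have := Finset.sum_le_sum fun i (_ : i ∈ Finset.univ) => hcon i
      rw [sum_received] at this
      exact absurd hl (not_le.2 (Nat.lt_succ_iff.2 this))
    obtain ⟨i, hi⟩ := hex
    have h1 := (hw l i).trans ((hp i).completionTime_le_iff.2 hi)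
    have h2 := (hp (w l)).completionTime_le_iff.1 h1
    intro i'
    rw [received_succ]
    split_ifs with h
    · subst h; exact h2
    · exact ih' i'

theorem IsArrivalOrder.arrivalTime_le {n : ℕ} {p : Fin n → ℝ → ℝ}
    (hp : ∀ i, IsComputationRate (p i)) {w : ℕ → Fin n} (hw : IsArrivalOrder p w) (t : ℝ≥0) {l : ℕ}
    (hl : l < numArrivals p t) : arrivalTime p w l ≤ t := by
  have h := hw.received_le hp t (l + 1) hl (w l)
  rw [received_succ, if_pos rfl] at h
  exact (hp (w l)).completionTime_le_iff.2 h

theorem IsArrivalOrder.received_numArrivals {n : ℕ} {p : Fin n → ℝ → ℝ}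
    (hp : ∀ i, IsComputationRate (p i)) {w : ℕ → Fin n} (hw : IsArrivalOrder p w) (t : ℝ≥0)
    (i : Fin n) : received w (numArrivals p t) i = numGradients (p i) 0 t := by
  have h := hw.received_le hp t _ le_rfl
  have hs : ∑ i, received w (numArrivals p t) i = ∑ i, numGradients (p i) 0 t :=
    sum_received w _
  exact (Finset.sum_eq_sum_iff_of_le fun i _ => h i).1 hs i (Finset.mem_univ i)

/-- One unit is lost because progress made before `a` does not count as a whole gradient, and one is
reserved for a discarded gradient. When the left side is positive, the integral is at least four
times it, which covers both; otherwise the claim is trivial. -/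
theorem IsComputationRate.floor_quarter_le {p : ℝ → ℝ} (hp : IsComputationRate p) {a b : ℝ}
    (ha : 0 ≤ a) (hab : a ≤ b) : ⌊(1 / 4 : ℝ) * ∫ s in a..b, p s⌋₊ ≤
      numGradients p 0 b - numGradients p 0 a - 1 := by
  rcases Nat.eq_zero_or_pos ⌊(1 / 4 : ℝ) * ∫ s in a..b, p s⌋₊ with h | h
  · omega
  have hI := hp.integral_nonneg ha hab
  have h1 : (⌊(1 / 4 : ℝ) * ∫ s in a..b, p s⌋₊ : ℝ) ≤ (1 / 4 : ℝ) * ∫ s in a..b, p s :=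
    Nat.floor_le (by positivity)
  have h2 : (numGradients p 0 a : ℝ) ≤ ∫ s in (0 : ℝ)..a, p s :=
    Nat.floor_le (hp.integral_nonneg le_rfl ha)
  have h3 : ⌊(1 / 4 : ℝ) * ∫ s in a..b, p s⌋₊ + 1 + numGradients p 0 a ≤ numGradients p 0 b := by
    refine Nat.le_floor ?_
    rw [← hp.integral_add ha (ha.trans hab)]
    have h' : (1 : ℝ) ≤ ⌊(1 / 4 : ℝ) * ∫ s in a..b, p s⌋₊ := by exact_mod_cast h
    push_cast
    linarith
  omega

/-- The number of updates made by time `t`. -/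
noncomputable def updatesBy {n : ℕ} (R : ℕ → ℝ) (p : Fin n → ℝ → ℝ) (w : ℕ → Fin n) (t : ℝ≥0) : ℕ :=
  (serverLog R w (numArrivals p t)).count

/-- By contradiction: with fewer than `r` new updates, no computation started inside the interval
can become too stale, so all but one gradient per worker are accepted, and these already number at
least `r`. -/
theorem IsArrivalOrder.updatesBy_gain {n : ℕ} {p : Fin n → ℝ → ℝ}
    (hp : ∀ i, IsComputationRate (p i)) {w : ℕ → Fin n} (hw : IsArrivalOrder p w) {R : ℕ → ℝ}
    {k₀ r : ℕ} (hR : ∀ k, k₀ ≤ k → ∀ δ < r, (δ : ℝ) < R k) {s t : ℝ≥0} (hst : s ≤ t)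
    (hk₀ : k₀ ≤ updatesBy R p w s)
    (hr : r ≤ ∑ i, ⌊(1 / 4 : ℝ) * ∫ u in s..t, p i u⌋₊) : k₀ + r ≤ updatesBy R p w t := by
  by_contra! hlt
  have hst' : (s : ℝ) ≤ t := by exact_mod_cast hst
  have hle : numArrivals p s ≤ numArrivals p t :=
    Finset.sum_le_sum fun i _ => (hp i).numGradients_mono s.2 hst'
  have h := (serverLog_count_gain w hR hk₀ (numArrivals p t - numArrivals p s)
    (by rwa [Nat.add_sub_cancel' hle])).1
  rw [Nat.add_sub_cancel' hle] at h
  simp only [hw.received_numArrivals hp] at h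
  have h2 := Finset.sum_le_sum fun i (_ : i ∈ Finset.univ) => (hp i).floor_quarter_le s.2 hst'
  rw [updatesBy] at hlt hk₀
  simp only [NNReal.val_eq_coe] at h2
  omega

theorem IsArrivalOrder.updateTime_le {n : ℕ} {p : Fin n → ℝ → ℝ}
    (hp : ∀ i, IsComputationRate (p i)) {w : ℕ → Fin n} (hw : IsArrivalOrder p w) {R : ℕ → ℝ}
    {K : ℕ} (hK : 1 ≤ K) {t : ℝ≥0} (h : K ≤ updatesBy R p w t) : updateTime R p w K ≤ t := by
  obtain ⟨l, hl⟩ : ∃ l, numArrivals p t = l + 1 := by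
    refine Nat.exists_eq_succ_of_ne_zero fun h0 => ?_
    rw [updatesBy, h0] at h
    exact absurd (hK.trans h) (by simp [serverLog])
  rw [updatesBy, hl] at h
  exact (iInf₂_le l h).trans (hw.arrivalTime_le hp t (by omega))

/-! ### The time bound for the square-root schedule -/

theorem IsArrivalOrder.updatesBy_timeBound_succ {n : ℕ} {p : Fin n → ℝ → ℝ}
    (hp : ∀ i, IsComputationRate (p i)) {w : ℕ → Fin n} (hw : IsArrivalOrder p w) {R : ℕ → ℝ}
    {k₀ j : ℕ} (hR : ∀ k, k₀ ≤ k → ∀ δ < max 1 ⌈(j : ℝ) / 3⌉₊, (δ : ℝ) < R k)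
    (htop : timeBound p (j + 1) ≠ ⊤)
    (hk₀ : k₀ ≤ updatesBy R p w (timeBound p j).toNNReal) :
    k₀ + max 1 ⌈(j : ℝ) / 3⌉₊ ≤ updatesBy R p w (timeBound p (j + 1)).toNNReal := by
  rw [timeBound] at htop
  obtain ⟨h1, h2⟩ := ENNReal.add_ne_top.1 htop
  obtain ⟨t, ht, heq⟩ := exists_eq_iInf_of_upperSemicontinuous
    (φ := fun t : ℝ≥0 => ∑ i, ⌊(1 / 4 : ℝ) *
      ∫ s in (timeBound p j).toReal..(timeBound p j).toReal + t, p i s⌋₊)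
    (fun t => by
      have : ∀ i, ∀ᶠ s : ℝ≥0 in nhds t, ⌊(1 / 4 : ℝ) *
          ∫ u in (timeBound p j).toReal..(timeBound p j).toReal + s, p i u⌋₊ ≤ ⌊(1 / 4 : ℝ) *
          ∫ u in (timeBound p j).toReal..(timeBound p j).toReal + t, p i u⌋₊ := fun i =>
        eventually_floor_le (continuous_const.mul ((hp i).continuous_integral
          ENNReal.toReal_nonneg)) t
      filter_upwards [Filter.eventually_all.2 this] with s hs
      exact Finset.sum_le_sum fun i _ => hs i) h2
  have heq' : blockDuration p (max 1 ⌈(j : ℝ) / 3⌉₊) (timeBound p j).toReal = t := heq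
  have hT : (timeBound p (j + 1)).toNNReal = (timeBound p j).toNNReal + t := by
    rw [timeBound, heq', ENNReal.toNNReal_add h1 ENNReal.coe_ne_top, ENNReal.toNNReal_coe]
  rw [hT]
  exact hw.updatesBy_gain hp hR le_self_add hk₀ ht

theorem sqrtSchedule_R_pos (h : ℝ) (k : ℕ) : 0 < (sqrtSchedule h).R k := by
  simp only [sqrtSchedule]
  split_ifs with hk
  · exact one_pos
  · exact Real.sqrt_pos.2 (by exact_mod_cast Nat.pos_of_ne_zero hk)

/-- For `m = 0` the case `k = 0` is included thanks to R₀ = 1; for `m ≥ 1` the term 2m makes √k > m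
strict. -/
theorem lt_sqrtSchedule_R (h : ℝ) {m k δ : ℕ} (hk : m ^ 2 + 2 * m ≤ k) (hδ : δ < m + 1) :
    (δ : ℝ) < (sqrtSchedule h).R k := by
  have hδm : (δ : ℝ) ≤ m := by exact_mod_cast Nat.lt_succ_iff.1 hδ
  simp only [sqrtSchedule]
  split_ifs with h0
  · have : m = 0 := by subst h0; nlinarith
    subst this
    exact hδm.trans_lt (by simp)
  · refine hδm.trans_lt ?_
    rw [Real.lt_sqrt (Nat.cast_nonneg m)]
    have : m ^ 2 < k := by
      rcases Nat.eq_zero_or_pos m with rfl | hm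
      · simpa using Nat.pos_of_ne_zero h0
      · omega
    exact_mod_cast this

theorem max_one_ceil_div_three {m a : ℕ} (h1 : 1 ≤ a) (h3 : a ≤ 3) :
    max 1 ⌈((3 * m + a : ℕ) : ℝ) / 3⌉₊ = m + 1 := by
  have : ⌈((3 * m + a : ℕ) : ℝ) / 3⌉₊ = m + 1 := by
    rw [Nat.ceil_eq_iff (Nat.succ_ne_zero m)]
    have h1' : (1 : ℝ) ≤ a := by exact_mod_cast h1
    have h3' : (a : ℝ) ≤ 3 := by exact_mod_cast h3
    rw [Nat.succ_sub_one]
    push_cast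
    constructor
    · linarith
    · linarith
  rw [this]
  exact max_eq_right (Nat.succ_pos m)

theorem timeBound_mono {n : ℕ} (p : Fin n → ℝ → ℝ) : Monotone (timeBound p) :=
  monotone_nat_of_le_succ fun _ => le_self_add

theorem IsArrivalOrder.le_updatesBy_timeBound {n : ℕ} {p : Fin n → ℝ → ℝ}
    (hp : ∀ i, IsComputationRate (p i)) {w : ℕ → Fin n} (hw : IsArrivalOrder p w) (h : ℝ) (m : ℕ)
    (htop : timeBound p (3 * m + 1) ≠ ⊤) :
    m ^ 2 + 2 * m ≤ updatesBy (sqrtSchedule h).R p w (timeBound p (3 * m + 1)).toNNReal := by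
  induction m with
  | zero => simp
  | succ m ih =>
    have hle : ∀ j, j ≤ 3 * (m + 1) + 1 → timeBound p j ≠ ⊤ := fun j hj =>
      ne_top_of_le_ne_top htop (timeBound_mono p hj)
    have h0 := ih (hle _ (by omega))
    have step : ∀ a, 1 ≤ a → a ≤ 3 → ∀ k₀, m ^ 2 + 2 * m ≤ k₀ →
        k₀ ≤ updatesBy (sqrtSchedule h).R p w (timeBound p (3 * m + a)).toNNReal →
        k₀ + (m + 1) ≤ updatesBy (sqrtSchedule h).R p w (timeBound p (3 * m + (a + 1))).toNNReal := by
      intro a h1 h3 k₀ hk hk₀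
      have hmax := max_one_ceil_div_three (m := m) h1 h3
      have := hw.updatesBy_timeBound_succ hp (R := (sqrtSchedule h).R) (k₀ := k₀) (j := 3 * m + a)
        (fun k hk' δ hδ => lt_sqrtSchedule_R h (hk.trans hk') (by rwa [hmax] at hδ))
        (hle _ (by omega)) hk₀
      rwa [hmax] at this
    have s1 := step 1 le_rfl (by norm_num) _ le_rfl h0
    have s2 := step 2 (by norm_num) (by norm_num) _ (by omega) s1
    have s3 := step 3 (by norm_num) le_rfl _ (by omega) s2
    rw [show 3 * (m + 1) + 1 = 3 * m + (3 + 1) by ring]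
    -- Three blocks add 3(m + 1), and m² + 5m + 3 ≥ (m + 1)² + 2(m + 1).
    refine le_trans ?_ s3
    nlinarith

theorem IsArrivalOrder.updateTime_le_timeBound {n : ℕ} {p : Fin n → ℝ → ℝ}
    (hp : ∀ i, IsComputationRate (p i)) {w : ℕ → Fin n} (hw : IsArrivalOrder p w) (h : ℝ) {K : ℕ}
    (hK : 1 ≤ K) : updateTime (sqrtSchedule h).R p w K ≤ timeBound p (3 * Nat.sqrt K + 1) := by
  by_cases htop : timeBound p (3 * Nat.sqrt K + 1) = ⊤
  · rw [htop]; exact le_top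
  have h1 := hw.le_updatesBy_timeBound hp h (Nat.sqrt K) htop
  have h2 : K ≤ Nat.sqrt K ^ 2 + 2 * Nat.sqrt K := by
    have := Nat.sqrt_le_add K
    nlinarith
  have h3 := hw.updateTime_le hp hK (h2.trans h1)
  rwa [ENNReal.coe_toNNReal htop] at h3

/-! ### Trajectories -/

/-- The momentum `m_k`. -/
noncomputable def momentum {d n : ℕ} {Ξ : Type*} (P : Schedule) (w : ℕ → Fin n) (lmo : Vec d → Vec d)
    (grad : Vec d → Ξ → Vec d) (x₀ m₀ : Vec d) (ξ : ℕ → Fin n → Ξ) (k : ℕ) : Vec d :=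
  (trajectory P w lmo grad x₀ m₀ ξ k).2

section Trajectory

variable {d n : ℕ} {Ξ : Type*} (P : Schedule) (w : ℕ → Fin n) (lmo : Vec d → Vec d)
  (grad : Vec d → Ξ → Vec d) (x₀ m₀ : Vec d) (ξ : ℕ → Fin n → Ξ)

theorem trajectory_fst_of_le {j k : ℕ} (hjk : j ≤ k) :
    (trajectory P w lmo grad x₀ m₀ ξ k).1 j = lmoIterate P w lmo grad x₀ m₀ ξ j := by
  induction k, hjk using Nat.le_induction with
  | base => rfl
  | succ k hk ih =>
    rw [← ih]
    exact Function.update_of_ne (Nat.lt_succ_of_le hk).ne _ _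

theorem lmoIterate_succ (k : ℕ) : lmoIterate P w lmo grad x₀ m₀ ξ (k + 1) =
    lmoIterate P w lmo grad x₀ m₀ ξ k +
      P.η k • lmo (momentum P w lmo grad x₀ m₀ ξ (k + 1)) :=
  Function.update_self _ _ _

theorem momentum_succ (hR : ∀ k, 0 < P.R k) (k : ℕ) : momentum P w lmo grad x₀ m₀ ξ (k + 1) =
    (1 - P.α k) • momentum P w lmo grad x₀ m₀ ξ k + (if k = 0 then P.αinit else P.α k) •
      grad (lmoIterate P w lmo grad x₀ m₀ ξ (acceptedOrigin P.R w k))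
        (ξ (acceptedOrigin P.R w k) (acceptedWorker P.R w k)) := by
  rw [momentum, trajectory]
  simp only [trajectory_fst_of_le P w lmo grad x₀ m₀ ξ (acceptedOrigin_le hR w k)]
  split_ifs with h
  · subst h; rfl
  · rfl

end Trajectory

/-! ### The stepsizes -/

/-- The fourth root of a natural number. -/
noncomputable def quarterRoot (k : ℕ) : ℝ := (k : ℝ) ^ (1 / 4 : ℝ)

theorem quarterRoot_nonneg (k : ℕ) : 0 ≤ quarterRoot k := by unfold quarterRoot; positivity

theorem quarterRoot_pow_four (k : ℕ) : quarterRoot k ^ 4 = k := by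
  rw [quarterRoot, ← Real.rpow_natCast, ← Real.rpow_mul (Nat.cast_nonneg k)]
  norm_num

theorem quarterRoot_sq (k : ℕ) : quarterRoot k ^ 2 = √(k : ℝ) := by
  rw [quarterRoot, ← Real.rpow_natCast, ← Real.rpow_mul (Nat.cast_nonneg k), Real.sqrt_eq_rpow]
  norm_num

theorem quarterRoot_pow_three (k : ℕ) : quarterRoot k ^ 3 = (k : ℝ) ^ (3 / 4 : ℝ) := by
  rw [quarterRoot, ← Real.rpow_natCast, ← Real.rpow_mul (Nat.cast_nonneg k)]
  norm_num

theorem quarterRoot_mono : Monotone quarterRoot := fun a b hab =>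
  Real.rpow_le_rpow (Nat.cast_nonneg a) (by exact_mod_cast hab) (by norm_num)

theorem quarterRoot_zero : quarterRoot 0 = 0 := by
  rw [quarterRoot, Nat.cast_zero, Real.zero_rpow (by norm_num)]

theorem one_le_quarterRoot {k : ℕ} (hk : 1 ≤ k) : 1 ≤ quarterRoot k :=
  Real.one_le_rpow (by exact_mod_cast hk) (by norm_num)

theorem quarterRoot_succ_pos (k : ℕ) : 0 < quarterRoot (k + 1) :=
  one_pos.trans_le (one_le_quarterRoot (by omega))

theorem sqrtSchedule_eta (h : ℝ) (k : ℕ) :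
    (sqrtSchedule h).η k = h / quarterRoot (k + 1) ^ 3 := by
  rw [quarterRoot_pow_three]
  simp [sqrtSchedule]

theorem sum_inv_quarterRoot_pow_three_le (K : ℕ) :
    ∑ k ∈ Finset.range K, 1 / quarterRoot (k + 1) ^ 3 ≤ 4 * quarterRoot K := by
  induction K with
  | zero => simp [quarterRoot_zero]
  | succ K ih =>
    rw [Finset.sum_range_succ]
    have hv := quarterRoot_nonneg K
    have hu := quarterRoot_succ_pos K
    have huv : quarterRoot K ≤ quarterRoot (K + 1) := quarterRoot_mono (Nat.le_succ K)
    have h4u := quarterRoot_pow_four (K + 1)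
    have h4v := quarterRoot_pow_four K
    push_cast at h4u
    set u := quarterRoot (K + 1)
    set v := quarterRoot K
    have hkey : 1 / u ^ 3 ≤ 4 * (u - v) := by
      rw [div_le_iff₀ (by positivity)]
      have h1 : (u - v) * (u ^ 3 + u ^ 2 * v + u * v ^ 2 + v ^ 3) = 1 := by
        linear_combination h4u - h4v
      have h2 : u ^ 3 + u ^ 2 * v + u * v ^ 2 + v ^ 3 ≤ 4 * u ^ 3 := by
        have a1 : u ^ 2 * v ≤ u ^ 2 * u := by gcongr
        have a2 : u * v ^ 2 ≤ u * u ^ 2 := by gcongr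
        have a3 : v ^ 3 ≤ u ^ 3 := by gcongr
        linarith [show u ^ 2 * u = u ^ 3 by ring, show u * u ^ 2 = u ^ 3 by ring]
      have h3 := mul_le_mul_of_nonneg_left h2 (sub_nonneg.2 huv)
      linarith
    linarith

theorem quarterRoot_le_sum (K : ℕ) :
    quarterRoot K ≤ ∑ k ∈ Finset.range K, 1 / quarterRoot (k + 1) ^ 3 := by
  rcases Nat.eq_zero_or_pos K with rfl | hK
  · simp [quarterRoot_zero]
  have hq : 0 < quarterRoot K := one_pos.trans_le (one_le_quarterRoot hK)
  calc quarterRoot K = ∑ k ∈ Finset.range K, 1 / quarterRoot K ^ 3 := by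
        rw [Finset.sum_const, Finset.card_range, nsmul_eq_mul, ← quarterRoot_pow_four K]
        field_simp
    _ ≤ _ := by
        refine Finset.sum_le_sum fun k hk => ?_
        have h1 : quarterRoot (k + 1) ≤ quarterRoot K := quarterRoot_mono (Finset.mem_range.1 hk)
        have h2 := quarterRoot_succ_pos k
        gcongr

theorem sum_inv_succ_le_one_add_log (K : ℕ) :
    ∑ k ∈ Finset.range K, 1 / ((k : ℝ) + 1) ≤ 1 + Real.log K := by
  have := harmonic_le_one_add_log K
  simpa [harmonic, one_div] using this

/-! ### The bias of the momentum -/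

/-- A stale gradient spans few indices: the step from `j` to `j + 1` lies in the delay window of
only about √j later updates. -/
theorem le_add_sqrt_of_stale {j k o : ℕ} (ho : ((k + 1 : ℕ) : ℝ) - o < √((k + 1 : ℕ) : ℝ))
    (hoj : o ≤ j) (hjk : j ≤ k) : k ≤ j + Nat.sqrt j := by
  obtain ⟨m, rfl⟩ := Nat.exists_eq_add_of_le hjk
  have h1 : ((m + 1 : ℕ) : ℝ) < √((j + m + 1 : ℕ) : ℝ) := by
    refine lt_of_le_of_lt ?_ ho
    have : (o : ℝ) ≤ j := by exact_mod_cast hoj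
    push_cast
    linarith
  rw [Real.lt_sqrt (Nat.cast_nonneg _)] at h1
  have h2 : (m + 1) ^ 2 < j + m + 1 := by exact_mod_cast h1
  have h3 : m ≤ Nat.sqrt j := Nat.le_sqrt'.2 (by nlinarith)
  omega

/-- After exchanging the sums, each increment `D j` is counted at most √j + 1 ≤ 2√(j+1) times, with
weight at most h/(j+1)^{3/4}. -/
theorem sum_staleness_le {h : ℝ} (hh : 0 ≤ h) {D : ℕ → ℝ} (hD : ∀ k, 0 ≤ D k) {o : ℕ → ℕ}
    (ho : ∀ k, ((k + 1 : ℕ) : ℝ) - o (k + 1) < √((k + 1 : ℕ) : ℝ)) (K : ℕ) :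
    ∑ k ∈ Finset.range K, h / quarterRoot (k + 1) ^ 3 *
        ∑ j ∈ Finset.Ico (o (k + 1)) (k + 1), D j ≤
      ∑ j ∈ Finset.range K, 2 * (h / quarterRoot (j + 1)) * D j := by
  have h1 : ∀ k ∈ Finset.range K, h / quarterRoot (k + 1) ^ 3 *
      ∑ j ∈ Finset.Ico (o (k + 1)) (k + 1), D j = ∑ j ∈ Finset.range K,
        if o (k + 1) ≤ j ∧ j < k + 1 then h / quarterRoot (k + 1) ^ 3 * D j else 0 := by
    intro k hk
    rw [← Finset.sum_filter, Finset.mul_sum]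
    refine Finset.sum_congr ?_ fun _ _ => rfl
    ext j
    have := Finset.mem_range.1 hk
    simp only [Finset.mem_Ico, Finset.mem_filter, Finset.mem_range]
    omega
  rw [Finset.sum_congr rfl h1, Finset.sum_comm]
  refine Finset.sum_le_sum fun j _ => ?_
  rw [← Finset.sum_filter]
  have hq := quarterRoot_succ_pos j
  have h2 : ∀ k ∈ (Finset.range K).filter (fun k => o (k + 1) ≤ j ∧ j < k + 1),
      h / quarterRoot (k + 1) ^ 3 * D j ≤ h / quarterRoot (j + 1) ^ 3 * D j := by
    intro k hk
    have hjk : j + 1 ≤ k + 1 := by have := (Finset.mem_filter.1 hk).2.2; omega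
    have := quarterRoot_mono hjk
    have := hD j
    gcongr
  have hcard : ((Finset.range K).filter (fun k => o (k + 1) ≤ j ∧ j < k + 1)).card ≤
      Nat.sqrt j + 1 := by
    refine (Finset.card_le_card (t := Finset.Icc j (j + Nat.sqrt j)) fun k hk => ?_).trans ?_
    · obtain ⟨-, hk1, hk2⟩ := Finset.mem_filter.1 hk
      exact Finset.mem_Icc.2 ⟨by omega, le_add_sqrt_of_stale (ho k) hk1 (by omega)⟩
    · rw [Nat.card_Icc]; omega
  have hcard' : (((Finset.range K).filter (fun k => o (k + 1) ≤ j ∧ j < k + 1)).card : ℝ) ≤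
      2 * quarterRoot (j + 1) ^ 2 := by
    have a1 : (Nat.sqrt j : ℝ) ≤ √(j : ℝ) := Real.nat_sqrt_le_real_sqrt
    have a2 : √(j : ℝ) ≤ √((j + 1 : ℕ) : ℝ) := Real.sqrt_le_sqrt (by push_cast; linarith)
    have a3 : (1 : ℝ) ≤ √((j + 1 : ℕ) : ℝ) := Real.one_le_sqrt.2 (by push_cast; linarith [Nat.cast_nonneg (α := ℝ) j])
    rw [quarterRoot_sq]
    have a4 : (((Finset.range K).filter (fun k => o (k + 1) ≤ j ∧ j < k + 1)).card : ℝ) ≤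
      Nat.sqrt j + 1 := by exact_mod_cast hcard
    linarith
  calc _ ≤ _ := Finset.sum_le_sum h2
    _ = ((Finset.range K).filter (fun k => o (k + 1) ≤ j ∧ j < k + 1)).card *
        (h / quarterRoot (j + 1) ^ 3 * D j) := by rw [Finset.sum_const, nsmul_eq_mul]
    _ ≤ 2 * quarterRoot (j + 1) ^ 2 * (h / quarterRoot (j + 1) ^ 3 * D j) := by
        have := hD j
        gcongr
    _ = _ := by field_simp

/-- With q = `quarterRoot (k + 1)`, the potential (h/q) b decreases at rate (h/q)·α = h/q³, which is
exactly the stepsize. The weighted biases therefore telescope. One of the three copies of the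
increments comes from drift, two from staleness. -/
theorem sum_bias_le {h : ℝ} (hh : 0 ≤ h) {b D : ℕ → ℝ} (hb : ∀ k, 0 ≤ b k) (hD : ∀ k, 0 ≤ D k)
    {o : ℕ → ℕ} (ho : ∀ k, ((k + 1 : ℕ) : ℝ) - o (k + 1) < √((k + 1 : ℕ) : ℝ)) (hb0 : b 0 = 0)
    (hrec : ∀ k, b (k + 1) ≤ (1 - 1 / √((k + 1 : ℕ) : ℝ)) * (b k + D k) +
      1 / √((k + 1 : ℕ) : ℝ) * ∑ j ∈ Finset.Ico (o (k + 1)) (k + 1), D j) (K : ℕ) :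
    ∑ k ∈ Finset.range K, h / quarterRoot (k + 1) ^ 3 * b k ≤
      ∑ j ∈ Finset.range K, 3 * (h / quarterRoot (j + 1)) * D j := by
  have key : ∑ k ∈ Finset.range K, h / quarterRoot (k + 1) ^ 3 * b k + h / quarterRoot K * b K ≤
      ∑ k ∈ Finset.range K, (h / quarterRoot (k + 1) * D k + h / quarterRoot (k + 1) ^ 3 *
        ∑ j ∈ Finset.Ico (o (k + 1)) (k + 1), D j) := by
    induction K with
    | zero => simp [hb0]
    | succ K ih =>
      rw [Finset.sum_range_succ, Finset.sum_range_succ]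
      have hu := quarterRoot_succ_pos K
      have hrK := hrec K
      rw [← quarterRoot_sq] at hrK
      -- At `K = 0` the coefficient `h / quarterRoot 0` is division by zero; this is harmless since
      -- `b 0 = 0`.
      have h1 : h / quarterRoot (K + 1) * b K ≤ h / quarterRoot K * b K := by
        rcases Nat.eq_zero_or_pos K with rfl | hK
        · simp [hb0]
        · have h2 : 0 < quarterRoot K := one_pos.trans_le (one_le_quarterRoot hK)
          have h3 : quarterRoot K ≤ quarterRoot (K + 1) := quarterRoot_mono (Nat.le_succ K)
          have := hb K
          gcongr
      have h4 := mul_le_mul_of_nonneg_left hrK (div_nonneg hh hu.le)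
      have h5 : h / quarterRoot (K + 1) * ((1 - 1 / quarterRoot (K + 1) ^ 2) * (b K + D K) +
          1 / quarterRoot (K + 1) ^ 2 * ∑ j ∈ Finset.Ico (o (K + 1)) (K + 1), D j) =
          h / quarterRoot (K + 1) * b K - h / quarterRoot (K + 1) ^ 3 * b K +
          h / quarterRoot (K + 1) * D K - h / quarterRoot (K + 1) ^ 3 * D K +
          h / quarterRoot (K + 1) ^ 3 * ∑ j ∈ Finset.Ico (o (K + 1)) (K + 1), D j := by
        field_simp
        ring
      rw [h5] at h4
      have h6 : 0 ≤ h / quarterRoot (K + 1) ^ 3 * D K :=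
        mul_nonneg (div_nonneg hh (by positivity)) (hD K)
      linarith
  have h1 := sum_staleness_le hh hD ho K
  have h2 : 0 ≤ h / quarterRoot K * b K :=
    mul_nonneg (div_nonneg hh (quarterRoot_nonneg K)) (hb K)
  rw [Finset.sum_add_distrib] at key
  have h3 : ∑ j ∈ Finset.range K, 3 * (h / quarterRoot (j + 1)) * D j =
      ∑ j ∈ Finset.range K, h / quarterRoot (j + 1) * D j +
        ∑ j ∈ Finset.range K, 2 * (h / quarterRoot (j + 1)) * D j := by
    rw [← Finset.sum_add_distrib]
    exact Finset.sum_congr rfl fun j _ => by ring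
  linarith

/-! ### The pathwise descent inequality -/

section Pathwise

variable {d : ℕ} {N : Seminorm ℝ (Vec d)} {f : Vec d → ℝ} {L₀ L₁ : ℝ} {lmo : Vec d → Vec d}
  {h : ℝ} {x m V : ℕ → Vec d}

theorem seminorm_step_le (hlmo : IsLMO N lmo) (hh : 0 ≤ h)
    (hx : ∀ k, x (k + 1) = x k + (h / quarterRoot (k + 1) ^ 3) • lmo (m (k + 1))) (k : ℕ) :
    N (x (k + 1) - x k) ≤ h / quarterRoot (k + 1) ^ 3 := by
  have hq := quarterRoot_succ_pos k
  rw [hx, add_sub_cancel_left, map_smul_eq_mul, Real.norm_of_nonneg (by positivity)]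
  exact mul_le_of_le_one_right (by positivity) (hlmo.apply_le_one _)

theorem seminorm_iterate_sub_le (hlmo : IsLMO N lmo) (hh : 0 ≤ h)
    (hx : ∀ k, x (k + 1) = x k + (h / quarterRoot (k + 1) ^ 3) • lmo (m (k + 1))) (k : ℕ) :
    N (x k - x 0) ≤ h * ∑ j ∈ Finset.range k, 1 / quarterRoot (j + 1) ^ 3 := by
  induction k with
  | zero => simp
  | succ k ih =>
    have h1 := map_add_le_add N (x (k + 1) - x k) (x k - x 0)
    rw [sub_add_sub_cancel] at h1
    have h2 := seminorm_step_le hlmo hh hx k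
    rw [Finset.sum_range_succ, mul_add, mul_one_div]
    linarith

/-- Oracle steps have length at most the stepsize, so the path length is bounded deterministically
by 4h times the fourth root. The exponential factor of the current step is included as one more
summand. -/
theorem modulus_iterate_le (hN : IsNorm N) (h₀ : 0 ≤ L₀) (h₁ : 0 ≤ L₁)
    (hf : IsGenSmooth N f L₀ L₁) (hlmo : IsLMO N lmo) (hh : 0 ≤ h)
    (hx : ∀ k, x (k + 1) = x k + (h / quarterRoot (k + 1) ^ 3) • lmo (m (k + 1))) (k : ℕ) :
    modulus N f L₀ L₁ (x k) * Real.exp (2 * (L₁ * (h / quarterRoot (k + 1) ^ 3))) ≤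
      modulus N f L₀ L₁ (x 0) * Real.exp (8 * (L₁ * h) * quarterRoot (k + 1)) := by
  have h1 := (hf.exp_growth hN h₁ h₀ (x 0) (x k)).1
  have h2 := seminorm_iterate_sub_le hlmo hh hx k
  have h3 := sum_inv_quarterRoot_pow_three_le (k + 1)
  rw [Finset.sum_range_succ] at h3
  have ha := modulus_nonneg hN f h₀ h₁ (x 0)
  calc _ ≤ modulus N f L₀ L₁ (x 0) * Real.exp (2 * (L₁ * N (x k - x 0))) *
        Real.exp (2 * (L₁ * (h / quarterRoot (k + 1) ^ 3))) := by gcongr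
    _ = modulus N f L₀ L₁ (x 0) * Real.exp (2 * L₁ * (N (x k - x 0) +
          h * (1 / quarterRoot (k + 1) ^ 3))) := by
        rw [mul_assoc, ← Real.exp_add]; congr 2; ring
    _ ≤ modulus N f L₀ L₁ (x 0) * Real.exp (2 * L₁ * (h * (4 * quarterRoot (k + 1)))) := by
        gcongr
        calc _ ≤ h * ∑ j ∈ Finset.range k, 1 / quarterRoot (j + 1) ^ 3 +
              h * (1 / quarterRoot (k + 1) ^ 3) := by gcongr
          _ = h * (∑ j ∈ Finset.range k, 1 / quarterRoot (j + 1) ^ 3 +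
              1 / quarterRoot (k + 1) ^ 3) := by ring
          _ ≤ _ := by gcongr
    _ = _ := by congr 2; ring

theorem descent_step (hN : IsNorm N) (h₀ : 0 ≤ L₀) (h₁ : 0 ≤ L₁) (hf : IsGenSmooth N f L₀ L₁)
    (hd : Differentiable ℝ f) (hlmo : IsLMO N lmo) (hh : 0 ≤ h)
    (hx : ∀ k, x (k + 1) = x k + (h / quarterRoot (k + 1) ^ 3) • lmo (m (k + 1))) (k : ℕ) :
    h / quarterRoot (k + 1) ^ 3 * dualNorm N (gradient f (x k)) ≤ f (x k) - f (x (k + 1)) +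
      2 * (h / quarterRoot (k + 1) ^ 3 * dualNorm N (m (k + 1) - gradient f (x k))) +
      modulus N f L₀ L₁ (x k) * Real.exp (2 * (L₁ * (h / quarterRoot (k + 1) ^ 3))) *
        (h / quarterRoot (k + 1) ^ 3) ^ 2 := by
  have h1 := hf.descent hN h₁ h₀ hd (x k) (x (k + 1))
  have h2 := seminorm_step_le hlmo hh hx k
  have hq := quarterRoot_succ_pos k
  set η := h / quarterRoot (k + 1) ^ 3 with hη
  have hη0 : 0 ≤ η := by positivity
  have ha := modulus_nonneg hN f h₀ h₁ (x k)
  have h3 : ⟪gradient f (x k), x (k + 1) - x k⟫_ℝ ≤ η * (-dualNorm N (gradient f (x k)) +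
      2 * dualNorm N (m (k + 1) - gradient f (x k))) := by
    rw [hx, add_sub_cancel_left, real_inner_smul_right]
    exact mul_le_mul_of_nonneg_left (hlmo.inner_apply_perturbed_le hN _ _) hη0
  have h4 : modulus N f L₀ L₁ (x k) * N (x (k + 1) - x k) ^ 2 *
      Real.exp (2 * (L₁ * N (x (k + 1) - x k))) ≤
      modulus N f L₀ L₁ (x k) * η ^ 2 * Real.exp (2 * (L₁ * η)) := by
    gcongr
  linarith

theorem gradient_step_le (hN : IsNorm N) (h₀ : 0 ≤ L₀) (h₁ : 0 ≤ L₁)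
    (hf : IsGenSmooth N f L₀ L₁) (hlmo : IsLMO N lmo) (hh : 0 ≤ h)
    (hx : ∀ k, x (k + 1) = x k + (h / quarterRoot (k + 1) ^ 3) • lmo (m (k + 1))) (k : ℕ) :
    dualNorm N (gradient f (x (k + 1)) - gradient f (x k)) ≤
      modulus N f L₀ L₁ (x k) * Real.exp (2 * (L₁ * (h / quarterRoot (k + 1) ^ 3))) *
        (h / quarterRoot (k + 1) ^ 3) := by
  have h1 := (hf.exp_growth hN h₁ h₀ (x k) (x (k + 1))).2
  have h2 := seminorm_step_le hlmo hh hx k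
  have ha := modulus_nonneg hN f h₀ h₁ (x k)
  refine h1.trans ?_
  rw [mul_right_comm]
  gcongr

/-- The triangle inequality turns the vector recursion for the bias into the scalar one; the delayed
gradient differs from the current one by a sum of increments over the delay window. -/
theorem sum_momentum_bias_le (hN : IsNorm N) (g : ℕ → Vec d) (hh : 0 ≤ h) {o : ℕ → ℕ}
    (ho : ∀ k, ((k + 1 : ℕ) : ℝ) - o (k + 1) < √((k + 1 : ℕ) : ℝ)) (ho' : ∀ k, o (k + 1) ≤ k + 1)
    {B : ℕ → Vec d} (hB0 : B 0 = 0)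
    (hB : ∀ k, B (k + 1) = (1 - 1 / √((k + 1 : ℕ) : ℝ)) • (B k + (g k - g (k + 1))) +
      (1 / √((k + 1 : ℕ) : ℝ)) • (g (o (k + 1)) - g (k + 1))) (K : ℕ) :
    ∑ k ∈ Finset.range K, h / quarterRoot (k + 1) ^ 3 * dualNorm N (B k) ≤
      ∑ j ∈ Finset.range K, 3 * (h / quarterRoot (j + 1)) * dualNorm N (g (j + 1) - g j) := by
  refine sum_bias_le hh (fun k => hN.dualNorm_nonneg _) (fun k => hN.dualNorm_nonneg _) ho
    (by rw [hB0, hN.dualNorm_zero]) (fun k => ?_) K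
  have hs : 1 ≤ √((k + 1 : ℕ) : ℝ) :=
    Real.one_le_sqrt.2 (by push_cast; linarith [Nat.cast_nonneg (α := ℝ) k])
  have hα0 : 0 ≤ 1 / √((k + 1 : ℕ) : ℝ) := by positivity
  have hα1 : 1 / √((k + 1 : ℕ) : ℝ) ≤ 1 := by rw [div_le_one (by positivity)]; exact hs
  rw [hB]
  refine (hN.dualNorm_add_le _ _).trans ?_
  rw [hN.dualNorm_smul, hN.dualNorm_smul, abs_of_nonneg hα0, abs_of_nonneg (sub_nonneg.2 hα1)]
  have h1 : dualNorm N (B k + (g k - g (k + 1))) ≤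
      dualNorm N (B k) + dualNorm N (g (k + 1) - g k) := by
    rw [hN.dualNorm_sub_rev (g (k + 1))]
    exact hN.dualNorm_add_le _ _
  have h2 : dualNorm N (g (o (k + 1)) - g (k + 1)) ≤
      ∑ j ∈ Finset.Ico (o (k + 1)) (k + 1), dualNorm N (g (j + 1) - g j) := by
    rw [hN.dualNorm_sub_rev, ← Finset.sum_Ico_sub g (ho' k)]
    exact Finset.le_sum_of_subadditive (dualNorm N) hN.dualNorm_zero.le hN.dualNorm_add_le _ _
  have := sub_nonneg.2 hα1
  gcongr

theorem exp_two_div_seventeen_le : Real.exp (2 / 17) ≤ 17 / 15 := by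
  have h1 := Real.one_sub_le_exp_neg (2 / 17)
  have hp := Real.exp_pos (2 / 17)
  rw [Real.exp_neg, ← one_div, le_div_iff₀ hp] at h1
  linarith

/-- Once the steps are short compared with `1 / L₁`, the smoothness error is absorbed by the
descent; before that, it is controlled by the smoothness modulus at the starting point. -/
theorem smoothness_error_le (hN : IsNorm N) (h₀ : 0 ≤ L₀) (h₁ : 0 ≤ L₁)
    (hf : IsGenSmooth N f L₀ L₁) (hlmo : IsLMO N lmo) (hh : 0 ≤ h)
    (hx : ∀ k, x (k + 1) = x k + (h / quarterRoot (k + 1) ^ 3) • lmo (m (k + 1))) (k : ℕ) :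
    7 * (h / quarterRoot (k + 1)) * (modulus N f L₀ L₁ (x k) *
        Real.exp (2 * (L₁ * (h / quarterRoot (k + 1) ^ 3))) * (h / quarterRoot (k + 1) ^ 3)) ≤
      7 / 15 * (h / quarterRoot (k + 1) ^ 3 * dualNorm N (gradient f (x k))) +
      8 * h ^ 2 * L₀ * (1 / ((k : ℝ) + 1)) + if quarterRoot (k + 1) < 17 * (L₁ * h) then
        7 * h ^ 2 * (modulus N f L₀ L₁ (x 0) * Real.exp (8 / 17 * (17 * (L₁ * h)) ^ 2)) else 0 := by
  have hq := quarterRoot_succ_pos k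
  have hq1 : 1 ≤ quarterRoot (k + 1) := one_le_quarterRoot (by omega)
  have hq4 := quarterRoot_pow_four (k + 1)
  push_cast at hq4
  have hmod := modulus_iterate_le hN h₀ h₁ hf hlmo hh hx k
  set q := quarterRoot (k + 1)
  set G := dualNorm N (gradient f (x k)) with hG
  have hG0 : 0 ≤ G := hN.dualNorm_nonneg _
  have ha := modulus_nonneg hN f h₀ h₁ (x k)
  have ha0 := modulus_nonneg hN f h₀ h₁ (x 0)
  have hE0 := Real.exp_pos (2 * (L₁ * (h / q ^ 3)))
  rw [← hq4]
  split_ifs with hbad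
  -- While q < A = 17L₁h, the exponent 8L₁hq is at most 8L₁hA = (8/17)A².
  · have h1 : modulus N f L₀ L₁ (x 0) * Real.exp (8 * (L₁ * h) * q) ≤
        modulus N f L₀ L₁ (x 0) * Real.exp (8 / 17 * (17 * (L₁ * h)) ^ 2) := by
      refine mul_le_mul_of_nonneg_left (Real.exp_le_exp.2 ?_) ha0
      have := mul_nonneg h₁ hh
      nlinarith
    have h2 : 7 * (h / q) * (h / q ^ 3) ≤ 7 * h ^ 2 := by
      rw [show 7 * (h / q) * (h / q ^ 3) = 7 * h ^ 2 / q ^ 4 by field_simp]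
      exact div_le_self (by positivity) (one_le_pow₀ hq1)
    have h3 : 7 * (h / q) * (h / q ^ 3) * (modulus N f L₀ L₁ (x k) *
        Real.exp (2 * (L₁ * (h / q ^ 3)))) ≤ 7 * h ^ 2 *
        (modulus N f L₀ L₁ (x 0) * Real.exp (8 / 17 * (17 * (L₁ * h)) ^ 2)) := by
      exact mul_le_mul h2 (hmod.trans h1) (mul_nonneg ha hE0.le) (by positivity)
    have h4 : 0 ≤ 7 / 15 * (h / q ^ 3 * G) := by positivity
    have h5 : 0 ≤ 8 * h ^ 2 * L₀ * (1 / q ^ 4) := by positivity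
    linarith
  · rw [not_lt] at hbad
    have h1 : Real.exp (2 * (L₁ * (h / q ^ 3))) ≤ 17 / 15 := by
      refine le_trans (Real.exp_le_exp.2 ?_) exp_two_div_seventeen_le
      have : L₁ * (h / q ^ 3) ≤ 1 / 17 := by
        rw [← mul_div_assoc, div_le_iff₀ (by positivity)]
        have : q ≤ q ^ 3 := le_self_pow₀ hq1 (by norm_num)
        linarith
      linarith
    have h2 : 7 * (h / q) * (modulus N f L₀ L₁ (x k) * Real.exp (2 * (L₁ * (h / q ^ 3))) *
        (h / q ^ 3)) ≤ 7 * (h / q) * (modulus N f L₀ L₁ (x k) * (17 / 15) * (h / q ^ 3)) := by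
      gcongr
    -- The number 17 is chosen so that 7e^{2/17} ≤ 7·17/15: the gradient part becomes
    -- (7/15)(17L₁h/q) times the descent term, and 17L₁h/q ≤ 1 here.
    have h3 : 7 * (h / q) * (modulus N f L₀ L₁ (x k) * (17 / 15) * (h / q ^ 3)) =
        119 / 15 * h ^ 2 * L₀ * (1 / q ^ 4) + 7 / 15 * (17 * (L₁ * h) / q) * (h / q ^ 3 * G) := by
      rw [modulus, ← hG]
      field_simp
      ring
    have h4 : 7 / 15 * (17 * (L₁ * h) / q) * (h / q ^ 3 * G) ≤ 7 / 15 * 1 * (h / q ^ 3 * G) := by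
      gcongr
      rwa [div_le_one hq]
    have h5 : 119 / 15 * h ^ 2 * L₀ * (1 / q ^ 4) ≤ 8 * h ^ 2 * L₀ * (1 / q ^ 4) := by
      gcongr
      norm_num
    linarith

theorem sum_ite_quarterRoot_lt_le {A c : ℝ} (hc : 0 ≤ c) (K : ℕ) :
    ∑ k ∈ Finset.range K, (if quarterRoot (k + 1) < A then c else 0) ≤ A ^ 4 * c := by
  rw [← Finset.sum_filter, Finset.sum_const, nsmul_eq_mul]
  gcongr
  have hsub : (Finset.range K).filter (fun k => quarterRoot (k + 1) < A) ⊆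
      Finset.range ⌊A ^ 4⌋₊ := by
    intro k hk
    have h1 := (Finset.mem_filter.1 hk).2
    have h2 : quarterRoot (k + 1) ^ 4 < A ^ 4 :=
      pow_lt_pow_left₀ h1 (quarterRoot_nonneg _) (by norm_num)
    rw [quarterRoot_pow_four] at h2
    exact Finset.mem_range.2 (Nat.le_floor h2.le)
  have h3 := Finset.card_le_card hsub
  rw [Finset.card_range] at h3
  exact (Nat.cast_le.2 h3).trans (Nat.floor_le (by positivity))

/-- Here `V` is the noise part of the momentum error and the remainder is the bias. The bias enters
the descent twice and costs three increments each time, and the descent has one smoothness error of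
its own; these are the 7 copies handled by `smoothness_error_le`. What survives of the descent is 1
− 7/15 = 8/15. -/
theorem sum_gradient_le (hN : IsNorm N) (h₀ : 0 ≤ L₀) (h₁ : 0 ≤ L₁) (hf : IsGenSmooth N f L₀ L₁)
    (hd : Differentiable ℝ f) (hlmo : IsLMO N lmo) (hh : 0 ≤ h) {fstar : ℝ}
    (hstar : ∀ x, fstar ≤ f x)
    (hx : ∀ k, x (k + 1) = x k + (h / quarterRoot (k + 1) ^ 3) • lmo (m (k + 1)))
    {o : ℕ → ℕ} (ho : ∀ k, ((k + 1 : ℕ) : ℝ) - o (k + 1) < √((k + 1 : ℕ) : ℝ))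
    (ho' : ∀ k, o (k + 1) ≤ k + 1) (hB0 : m 1 - gradient f (x 0) - V 0 = 0)
    (hB : ∀ k, m (k + 1 + 1) - gradient f (x (k + 1)) - V (k + 1) =
      (1 - 1 / √((k + 1 : ℕ) : ℝ)) • (m (k + 1) - gradient f (x k) - V k +
        (gradient f (x k) - gradient f (x (k + 1)))) +
      (1 / √((k + 1 : ℕ) : ℝ)) • (gradient f (x (o (k + 1))) - gradient f (x (k + 1)))) (K : ℕ) :
    8 / 15 * ∑ k ∈ Finset.range K,
        h / quarterRoot (k + 1) ^ 3 * dualNorm N (gradient f (x k)) ≤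
      (f (x 0) - fstar) + 2 * ∑ k ∈ Finset.range K, h / quarterRoot (k + 1) ^ 3 * dualNorm N (V k) +
      8 * h ^ 2 * L₀ * (1 + Real.log K) + 7 * h ^ 2 * (17 * (L₁ * h)) ^ 4 *
        (modulus N f L₀ L₁ (x 0) * Real.exp (8 / 17 * (17 * (L₁ * h)) ^ 2)) := by
  have hbias := sum_momentum_bias_le hN (fun k => gradient f (x k)) hh ho ho'
    (B := fun k => m (k + 1) - gradient f (x k) - V k) hB0 hB K
  have hstep : ∀ k ∈ Finset.range K,
      h / quarterRoot (k + 1) ^ 3 * dualNorm N (gradient f (x k)) ≤ (f (x k) - f (x (k + 1))) +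
      2 * (h / quarterRoot (k + 1) ^ 3 * dualNorm N (m (k + 1) - gradient f (x k) - V k)) +
      2 * (h / quarterRoot (k + 1) ^ 3 * dualNorm N (V k)) +
      (h / quarterRoot (k + 1)) * (modulus N f L₀ L₁ (x k) *
        Real.exp (2 * (L₁ * (h / quarterRoot (k + 1) ^ 3))) * (h / quarterRoot (k + 1) ^ 3)) := by
    intro k _
    have hq := quarterRoot_succ_pos k
    have hq1 : 1 ≤ quarterRoot (k + 1) := one_le_quarterRoot (by omega)
    have h1 := descent_step hN h₀ h₁ hf hd hlmo hh hx k
    have h2 := hN.dualNorm_add_le (m (k + 1) - gradient f (x k) - V k) (V k)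
    rw [sub_add_cancel] at h2
    have h3 : h / quarterRoot (k + 1) ^ 3 * dualNorm N (m (k + 1) - gradient f (x k)) ≤
        h / quarterRoot (k + 1) ^ 3 *
          (dualNorm N (m (k + 1) - gradient f (x k) - V k) + dualNorm N (V k)) := by gcongr
    have h4 : h / quarterRoot (k + 1) ^ 3 ≤ h / quarterRoot (k + 1) := by
      gcongr
      exact le_self_pow₀ hq1 (by norm_num)
    have ha := modulus_nonneg hN f h₀ h₁ (x k)
    have h5 : modulus N f L₀ L₁ (x k) * Real.exp (2 * (L₁ * (h / quarterRoot (k + 1) ^ 3))) *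
        (h / quarterRoot (k + 1) ^ 3) ^ 2 ≤ (h / quarterRoot (k + 1)) * (modulus N f L₀ L₁ (x k) *
        Real.exp (2 * (L₁ * (h / quarterRoot (k + 1) ^ 3))) * (h / quarterRoot (k + 1) ^ 3)) := by
      rw [sq, ← mul_assoc, mul_comm _ (h / quarterRoot (k + 1) ^ 3)]
      gcongr
    linarith
  have hsum := Finset.sum_le_sum hstep
  rw [Finset.sum_add_distrib, Finset.sum_add_distrib, Finset.sum_add_distrib,
    Finset.sum_range_sub' (fun k => f (x k)), ← Finset.mul_sum, ← Finset.mul_sum] at hsum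
  have hgrad : ∑ j ∈ Finset.range K, 3 * (h / quarterRoot (j + 1)) *
      dualNorm N (gradient f (x (j + 1)) - gradient f (x j)) ≤
      3 * ∑ k ∈ Finset.range K, (h / quarterRoot (k + 1)) * (modulus N f L₀ L₁ (x k) *
        Real.exp (2 * (L₁ * (h / quarterRoot (k + 1) ^ 3))) * (h / quarterRoot (k + 1) ^ 3)) := by
    rw [Finset.mul_sum]
    refine Finset.sum_le_sum fun k _ => ?_
    have hq := quarterRoot_succ_pos k
    rw [mul_assoc]
    gcongr
    exact gradient_step_le hN h₀ h₁ hf hlmo hh hx k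
  have herr := Finset.sum_le_sum fun k (_ : k ∈ Finset.range K) =>
    smoothness_error_le hN h₀ h₁ hf hlmo hh hx k
  simp only [mul_assoc (7 : ℝ) (h / _)] at herr
  rw [Finset.sum_add_distrib, Finset.sum_add_distrib, ← Finset.mul_sum, ← Finset.mul_sum,
    ← Finset.mul_sum] at herr
  have ha0 := modulus_nonneg hN f h₀ h₁ (x 0)
  have hbad := sum_ite_quarterRoot_lt_le (A := 17 * (L₁ * h))
    (c := 7 * h ^ 2 * (modulus N f L₀ L₁ (x 0) * Real.exp (8 / 17 * (17 * (L₁ * h)) ^ 2)))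
    (by positivity) K
  have hlog : 8 * h ^ 2 * L₀ * ∑ k ∈ Finset.range K, 1 / ((k : ℝ) + 1) ≤
      8 * h ^ 2 * L₀ * (1 + Real.log K) :=
    mul_le_mul_of_nonneg_left (sum_inv_succ_le_one_add_log K) (by positivity)
  have hfK := hstar (x K)
  linarith

end Pathwise

/-! ### Measurability of the stochastic gradient -/

/-- A function continuous in `x` and measurable in the sample is jointly measurable, and each
coordinate of the gradient is a pointwise limit of difference quotients. -/
theorem measurable_stochGrad {d : ℕ} {Ξ : Type*} [MeasurableSpace Ξ] {F : Vec d → Ξ → ℝ}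
    (hm : ∀ x, Measurable (F x)) (hd : ∀ s, Differentiable ℝ fun x => F x s) :
    Measurable fun z : Vec d × Ξ => stochGrad F z.1 z.2 := by
  have hF : Measurable (Function.uncurry F) :=
    measurable_uncurry_of_continuous_of_measurable (fun s => (hd s).continuous) hm
  set b := EuclideanSpace.basisFun (Fin d) ℝ
  have hcoord : ∀ i, Measurable fun z : Vec d × Ξ => ⟪b i, stochGrad F z.1 z.2⟫_ℝ := by
    intro i
    refine measurable_of_tendsto_metrizable
      (f := fun (n : ℕ) (z : Vec d × Ξ) =>
        ((n : ℝ)) • (F (z.1 + ((n : ℝ))⁻¹ • b i) z.2 - F z.1 z.2)) (fun n => ?_) ?_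
    · have h1 : Measurable fun z : Vec d × Ξ => F (z.1 + ((n : ℝ))⁻¹ • b i) z.2 :=
        hF.comp ((measurable_fst.add_const _).prodMk measurable_snd)
      exact (h1.sub hF).const_smul (n : ℝ)
    · rw [tendsto_pi_nhds]
      intro z
      have h := (hd z.2 z.1).hasFDerivAt.lim (b i) (c := fun n : ℕ => (n : ℝ))
        (l := Filter.atTop) (by simpa using tendsto_natCast_atTop_atTop (R := ℝ))
      have he : ⟪b i, stochGrad F z.1 z.2⟫_ℝ = fderiv ℝ (fun x => F x z.2) z.1 (b i) := by
        rw [real_inner_comm, stochGrad, gradient, InnerProductSpace.toDual_symm_apply]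
      rw [he]
      exact h
  have hsum : (fun z : Vec d × Ξ => stochGrad F z.1 z.2) =
      fun z => ∑ i, ⟪b i, stochGrad F z.1 z.2⟫_ℝ • b i := by
    funext z
    exact (b.sum_repr' _).symm
  rw [hsum]
  exact Finset.measurable_sum _ fun i _ => (hcoord i).smul_const _

theorem measurable_momentum_lmoIterate {d n : ℕ} {Ξ Ω : Type*} [MeasurableSpace Ξ]
    [MeasurableSpace Ω] {P : Schedule} (hR : ∀ k, 0 < P.R k) (w : ℕ → Fin n)
    {lmo : Vec d → Vec d} (hlmo : Measurable lmo) {grad : Vec d → Ξ → Vec d}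
    (hgrad : Measurable fun z : Vec d × Ξ => grad z.1 z.2) (x₀ m₀ : Vec d)
    {ξ : ℕ → Fin n → Ω → Ξ} (k : ℕ)
    (hξ : ∀ j < k, Measurable (ξ (acceptedOrigin P.R w j) (acceptedWorker P.R w j))) :
    Measurable (fun ω => momentum P w lmo grad x₀ m₀ (fun j i => ξ j i ω) k) ∧
      ∀ j ≤ k, Measurable fun ω => lmoIterate P w lmo grad x₀ m₀ (fun j i => ξ j i ω) j := by
  induction k with
  | zero =>
    refine ⟨measurable_const, fun j hj => ?_⟩
    rw [Nat.le_zero.1 hj]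
    exact measurable_const
  | succ k ih =>
    obtain ⟨h1, h2⟩ := ih fun j hj => hξ j (by omega)
    have hm : Measurable fun ω => momentum P w lmo grad x₀ m₀ (fun j i => ξ j i ω) (k + 1) := by
      simp only [momentum_succ P w lmo grad x₀ m₀ _ hR]
      have hg : Measurable fun ω => grad
          (lmoIterate P w lmo grad x₀ m₀ (fun j i => ξ j i ω) (acceptedOrigin P.R w k))
          (ξ (acceptedOrigin P.R w k) (acceptedWorker P.R w k) ω) :=
        hgrad.comp ((h2 _ (acceptedOrigin_le hR w k)).prodMk (hξ k (by omega)))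
      exact (h1.const_smul (1 - P.α k)).add (hg.const_smul (if k = 0 then P.αinit else P.α k))
    refine ⟨hm, fun j hj => ?_⟩
    rcases Nat.lt_or_ge j (k + 1) with h | h
    · exact h2 j (by omega)
    · rw [le_antisymm hj h]
      simp only [lmoIterate_succ]
      have hl : Measurable fun ω =>
          lmo (momentum P w lmo grad x₀ m₀ (fun j i => ξ j i ω) (k + 1)) := hlmo.comp hm
      exact (h2 k le_rfl).add (hl.const_smul (P.η k))

/-! ### Independence and square-integrable noise -/

theorem integrable_inner_of_memLp_two {Ω E : Type*} [MeasurableSpace Ω] {μ : Measure Ω}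
    [NormedAddCommGroup E] [InnerProductSpace ℝ E] {f g : Ω → E} (hf : MemLp f 2 μ)
    (hg : MemLp g 2 μ) : Integrable (fun ω => ⟪f ω, g ω⟫_ℝ) μ := by
  have h1 := (memLp_two_iff_integrable_sq_norm hf.1).1 hf
  have h2 := (memLp_two_iff_integrable_sq_norm hg.1).1 hg
  refine (h1.add h2).mono' (hf.1.inner hg.1) (Filter.Eventually.of_forall fun ω => ?_)
  have := norm_inner_le_norm (𝕜 := ℝ) (f ω) (g ω)
  simp only [Pi.add_apply]
  nlinarith [sq_nonneg (‖f ω‖ - ‖g ω‖), norm_nonneg (f ω), norm_nonneg (g ω)]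

/-- A random variable that is a function of the other members of an independent family is
independent of the remaining member. -/
theorem indepFun_of_measurable_iSup_compl {Ω Ξ β ι : Type*} [MeasurableSpace Ω]
    [mΞ : MeasurableSpace Ξ] [MeasurableSpace β] {μ : Measure Ω} {X : ι → Ω → Ξ}
    (hX : ∀ i, Measurable (X i)) (hind : iIndepFun X μ) (i : ι) {Y : Ω → β}
    (hY : Measurable[⨆ j ∈ ({i}ᶜ : Set ι), MeasurableSpace.comap (X j) mΞ] Y) :
    IndepFun Y (X i) μ := by
  rw [IndepFun_iff_Indep]
  have h := indep_iSup_of_disjoint (fun j => (hX j).comap_le) hind.iIndep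
    (S := ({i}ᶜ : Set ι)) (T := {i}) (Set.disjoint_compl_left_iff_subset.2 subset_rfl)
  refine indep_of_indep_of_le_left (indep_of_indep_of_le_right h ?_) hY.comap_le
  exact le_iSup₂_of_le i rfl le_rfl

section Noise

variable {d : ℕ} {Ξ Ω : Type*} [MeasurableSpace Ξ] [MeasurableSpace Ω] {D : Measure Ξ}
  [IsProbabilityMeasure D] {σ : ℝ} {μ : Measure Ω} [IsProbabilityMeasure μ]
  {Φ : Vec d × Ξ → Vec d}

theorem integrable_sq_prod (hΦ : Measurable Φ) (hsq : ∀ x, Integrable (fun s => ‖Φ (x, s)‖ ^ 2) D)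
    (hσ : ∀ x, ∫ s, ‖Φ (x, s)‖ ^ 2 ∂D ≤ σ ^ 2) (ν : Measure (Vec d)) [IsProbabilityMeasure ν] :
    Integrable (fun z => ‖Φ z‖ ^ 2) (ν.prod D) := by
  have hm := (hΦ.norm.pow_const 2).aestronglyMeasurable (μ := ν.prod D)
  rw [integrable_prod_iff hm]
  refine ⟨Filter.Eventually.of_forall hsq, ?_⟩
  refine (integrable_const (σ ^ 2)).mono' hm.norm.integral_prod_right'
    (Filter.Eventually.of_forall fun x => ?_)
  simp only [norm_pow, norm_norm]
  rw [Real.norm_of_nonneg (integral_nonneg fun s => by positivity)]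
  exact hσ x

theorem memLp_two_of_indepFun (hΦ : Measurable Φ)
    (hsq : ∀ x, Integrable (fun s => ‖Φ (x, s)‖ ^ 2) D)
    (hσ : ∀ x, ∫ s, ‖Φ (x, s)‖ ^ 2 ∂D ≤ σ ^ 2) {Y : Ω → Vec d} {X : Ω → Ξ}
    (hY : Measurable Y) (hX : Measurable X) (hXD : μ.map X = D) (hind : IndepFun Y X μ) :
    MemLp (fun ω => Φ (Y ω, X ω)) 2 μ ∧ ∫ ω, ‖Φ (Y ω, X ω)‖ ^ 2 ∂μ ≤ σ ^ 2 := by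
  have hmap := (indepFun_iff_map_prod_eq_prod_map_map hY.aemeasurable hX.aemeasurable).1 hind
  rw [hXD] at hmap
  have : IsProbabilityMeasure (μ.map Y) := Measure.isProbabilityMeasure_map hY.aemeasurable
  have hYX : Measurable fun ω => (Y ω, X ω) := hY.prodMk hX
  have hint := integrable_sq_prod hΦ hsq hσ (μ.map Y)
  constructor
  · refine (memLp_two_iff_integrable_sq_norm (hΦ.comp hYX).aestronglyMeasurable).2 ?_
    rw [← hmap] at hint
    exact hint.comp_measurable hYX
  · have h1 : ∫ ω, ‖Φ (Y ω, X ω)‖ ^ 2 ∂μ = ∫ z, ‖Φ z‖ ^ 2 ∂((μ.map Y).prod D) := by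
      rw [← hmap]
      exact (integral_map hYX.aemeasurable (hΦ.norm.pow_const 2).aestronglyMeasurable).symm
    rw [h1, integral_prod _ hint]
    calc _ ≤ ∫ _, σ ^ 2 ∂(μ.map Y) :=
          integral_mono hint.integral_prod_left (integrable_const _) hσ
      _ = σ ^ 2 := by simp

/-- By independence the joint law is a product, and Fubini integrates out the fresh sample first,
with `Z` and `Y` frozen. -/
theorem integral_inner_eq_zero_of_indepFun (hΦ : Measurable Φ)
    (hsq : ∀ x, Integrable (fun s => ‖Φ (x, s)‖ ^ 2) D)
    (hσ : ∀ x, ∫ s, ‖Φ (x, s)‖ ^ 2 ∂D ≤ σ ^ 2) (hint : ∀ x, Integrable (fun s => Φ (x, s)) D)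
    (h0 : ∀ x, ∫ s, Φ (x, s) ∂D = 0) {Y Z : Ω → Vec d} {X : Ω → Ξ} (hY : Measurable Y)
    (hZ : Measurable Z) (hX : Measurable X) (hXD : μ.map X = D)
    (hind : IndepFun (fun ω => (Z ω, Y ω)) X μ) (hZ2 : MemLp Z 2 μ) :
    ∫ ω, ⟪Z ω, Φ (Y ω, X ω)⟫_ℝ ∂μ = 0 := by
  have hZY : Measurable fun ω => (Z ω, Y ω) := hZ.prodMk hY
  have hmap := (indepFun_iff_map_prod_eq_prod_map_map hZY.aemeasurable hX.aemeasurable).1 hind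
  rw [hXD] at hmap
  have : IsProbabilityMeasure (μ.map fun ω => (Z ω, Y ω)) :=
    Measure.isProbabilityMeasure_map hZY.aemeasurable
  have hindY : IndepFun Y X μ := hind.comp measurable_snd measurable_id
  have hint1 := integrable_inner_of_memLp_two hZ2
    (memLp_two_of_indepFun hΦ hsq hσ hY hX hXD hindY).1
  have hZYX : Measurable fun ω => ((Z ω, Y ω), X ω) := hZY.prodMk hX
  have hmeas : Measurable fun z : (Vec d × Vec d) × Ξ => ⟪z.1.1, Φ (z.1.2, z.2)⟫_ℝ :=
    (measurable_fst.comp measurable_fst).inner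
      (hΦ.comp ((measurable_snd.comp measurable_fst).prodMk measurable_snd))
  have h1 : ∫ ω, ⟪Z ω, Φ (Y ω, X ω)⟫_ℝ ∂μ =
      ∫ z, ⟪z.1.1, Φ (z.1.2, z.2)⟫_ℝ ∂((μ.map fun ω => (Z ω, Y ω)).prod D) := by
    rw [← hmap]
    exact (integral_map hZYX.aemeasurable hmeas.aestronglyMeasurable).symm
  have hint2 : Integrable (fun z : (Vec d × Vec d) × Ξ => ⟪z.1.1, Φ (z.1.2, z.2)⟫_ℝ)
      ((μ.map fun ω => (Z ω, Y ω)).prod D) := by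
    rw [← hmap]
    exact (integrable_map_measure hmeas.aestronglyMeasurable hZYX.aemeasurable).2 hint1
  rw [h1, integral_prod _ hint2]
  have h2 : ∀ z : Vec d × Vec d, ∫ s, ⟪z.1, Φ (z.2, s)⟫_ℝ ∂D = 0 := fun z => by
    rw [integral_inner (hint z.2), h0, inner_zero_right]
  simp [h2]

end Noise

/-! ### Exponential averages of orthogonal noise -/

/-- The average `V_0 = e_0`, `V_{k+1} = (1 - a_{k+1}) V_k + a_{k+1} e_{k+1}`. -/
def noiseAverage {E : Type*} [AddCommGroup E] [Module ℝ E] (a : ℕ → ℝ) (e : ℕ → E) : ℕ → E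
  | 0 => e 0
  | k + 1 => (1 - a (k + 1)) • noiseAverage a e k + a (k + 1) • e (k + 1)

section NoiseAverage

variable {Ω E : Type*} [MeasurableSpace Ω] {μ : Measure Ω} [NormedAddCommGroup E]
  [InnerProductSpace ℝ E] {e : ℕ → Ω → E} (a : ℕ → ℝ)

theorem memLp_noiseAverage (he : ∀ k, MemLp (e k) 2 μ) (k : ℕ) :
    MemLp (fun ω => noiseAverage a (fun j => e j ω) k) 2 μ := by
  induction k with
  | zero => exact he 0
  | succ k ih => exact (ih.const_smul _).add ((he (k + 1)).const_smul _)

theorem integral_inner_noiseAverage (he : ∀ k, MemLp (e k) 2 μ)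
    (horth : ∀ j k, j < k → ∫ ω, ⟪e j ω, e k ω⟫_ℝ ∂μ = 0) {j k : ℕ} (hjk : j < k) :
    ∫ ω, ⟪noiseAverage a (fun j => e j ω) j, e k ω⟫_ℝ ∂μ = 0 := by
  induction j with
  | zero => exact horth 0 k hjk
  | succ j ih =>
    simp only [noiseAverage, inner_add_left, real_inner_smul_left]
    rw [integral_add ((integrable_inner_of_memLp_two (memLp_noiseAverage a he j) (he k)).const_mul _)
      ((integrable_inner_of_memLp_two (he (j + 1)) (he k)).const_mul _),
      integral_const_mul, integral_const_mul, ih (by omega), horth _ _ hjk]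
    simp

theorem integral_noiseAverage_sq_succ (he : ∀ k, MemLp (e k) 2 μ)
    (horth : ∀ j k, j < k → ∫ ω, ⟪e j ω, e k ω⟫_ℝ ∂μ = 0) (k : ℕ) :
    ∫ ω, ‖noiseAverage a (fun j => e j ω) (k + 1)‖ ^ 2 ∂μ =
      (1 - a (k + 1)) ^ 2 * ∫ ω, ‖noiseAverage a (fun j => e j ω) k‖ ^ 2 ∂μ +
        a (k + 1) ^ 2 * ∫ ω, ‖e (k + 1) ω‖ ^ 2 ∂μ := by
  have hV := memLp_noiseAverage a he k
  have h1 := (memLp_two_iff_integrable_sq_norm hV.1).1 hV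
  have h2 := (memLp_two_iff_integrable_sq_norm (he (k + 1)).1).1 (he (k + 1))
  have h3 := integrable_inner_of_memLp_two hV (he (k + 1))
  have hexp : ∀ ω, ‖noiseAverage a (fun j => e j ω) (k + 1)‖ ^ 2 =
      (1 - a (k + 1)) ^ 2 * ‖noiseAverage a (fun j => e j ω) k‖ ^ 2 +
        2 * (1 - a (k + 1)) * a (k + 1) * ⟪noiseAverage a (fun j => e j ω) k, e (k + 1) ω⟫_ℝ +
        a (k + 1) ^ 2 * ‖e (k + 1) ω‖ ^ 2 := by
    intro ω
    rw [noiseAverage, norm_add_sq_real, norm_smul, norm_smul, mul_pow, mul_pow, Real.norm_eq_abs,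
      Real.norm_eq_abs, sq_abs, sq_abs, real_inner_smul_left, real_inner_smul_right]
    ring
  simp only [hexp]
  have h13 := (h1.const_mul ((1 - a (k + 1)) ^ 2)).add
    (h3.const_mul (2 * (1 - a (k + 1)) * a (k + 1)))
  have h4 := integral_add h13 (h2.const_mul (a (k + 1) ^ 2))
  simp only [Pi.add_apply] at h4
  rw [h4, integral_add (h1.const_mul _) (h3.const_mul _), integral_const_mul, integral_const_mul,
    integral_const_mul, integral_inner_noiseAverage a he horth (Nat.lt_succ_self k)]
  ring

theorem integral_noiseAverage_sq_le {σ : ℝ} (he : ∀ k, MemLp (e k) 2 μ)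
    (horth : ∀ j k, j < k → ∫ ω, ⟪e j ω, e k ω⟫_ℝ ∂μ = 0)
    (hσ : ∀ k, ∫ ω, ‖e k ω‖ ^ 2 ∂μ ≤ σ ^ 2) (k : ℕ) :
    ∫ ω, ‖noiseAverage (fun k => 1 / √(k : ℝ)) (fun j => e j ω) k‖ ^ 2 ∂μ ≤
      σ ^ 2 * if k = 0 then 1 else 1 / √(k : ℝ) := by
  induction k with
  | zero => simpa [noiseAverage] using hσ 0
  | succ k ih =>
    rw [integral_noiseAverage_sq_succ _ he horth]
    simp only [if_neg (Nat.succ_ne_zero k)]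
    set s := √((k + 1 : ℕ) : ℝ) with hs
    have hs1 : 1 ≤ s := Real.one_le_sqrt.2 (by push_cast; linarith [Nat.cast_nonneg (α := ℝ) k])
    have ha1 : 1 / s ≤ 1 := by rw [div_le_one (by positivity)]; exact hs1
    have ha0 : 0 ≤ 1 / s := by positivity
    -- This is where √(k+1) − 1 ≤ √k is used: it makes the bound σ²α_k self-reproducing, since (1 −
    -- α)²α_k + α² ≤ (1 − α)α + α² = α for α = α_{k+1}.
    have hkey : (1 - 1 / s) * (if k = 0 then 1 else 1 / √(k : ℝ)) ≤ 1 / s := by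
      split_ifs with hk
      · rw [hs, hk]; simp
      · have ht : 0 < √(k : ℝ) := Real.sqrt_pos.2 (by exact_mod_cast Nat.pos_of_ne_zero hk)
        have h1 : s - 1 ≤ √(k : ℝ) := by
          refine Real.le_sqrt_of_sq_le ?_
          have : s ^ 2 = k + 1 := by rw [hs, Real.sq_sqrt (Nat.cast_nonneg _)]; push_cast; ring
          nlinarith
        rw [show (1 - 1 / s) * (1 / √(k : ℝ)) = ((s - 1) / √(k : ℝ)) * (1 / s) by field_simp]
        refine mul_le_of_le_one_left ha0 ((div_le_one ht).2 h1)
    have hb : 0 ≤ 1 - 1 / s := sub_nonneg.2 ha1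
    calc _ ≤ (1 - 1 / s) ^ 2 * (σ ^ 2 * if k = 0 then 1 else 1 / √(k : ℝ)) +
          (1 / s) ^ 2 * σ ^ 2 := by gcongr; exact hσ (k + 1)
      _ = σ ^ 2 * ((1 - 1 / s) * ((1 - 1 / s) * (if k = 0 then 1 else 1 / √(k : ℝ))) +
          (1 / s) ^ 2) := by ring
      _ ≤ σ ^ 2 * ((1 - 1 / s) * (1 / s) + (1 / s) ^ 2) := by gcongr
      _ = _ := by ring

end NoiseAverage

/-- Jensen's inequality, read off from the nonnegativity of the variance of the norm. -/
theorem integral_norm_le_of_integral_sq_le {Ω E : Type*} [MeasurableSpace Ω]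
    {μ : Measure Ω} [NormedAddCommGroup E] [IsProbabilityMeasure μ] {f : Ω → E} {c : ℝ}
    (hf : MemLp f 2 μ) (hc : 0 ≤ c) (h : ∫ ω, ‖f ω‖ ^ 2 ∂μ ≤ c ^ 2) : ∫ ω, ‖f ω‖ ∂μ ≤ c := by
  have h1 := variance_nonneg (fun ω => ‖f ω‖) μ
  rw [variance_eq_sub hf.norm] at h1
  have h2 : (∫ ω, ‖f ω‖ ∂μ) ^ 2 ≤ c ^ 2 := (sub_nonneg.1 h1).trans h
  exact le_of_sq_le_sq h2 hc

/-! ### The gradient noise along the trajectory -/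

/-- The noise of the stochastic gradient used in the `k`-th update. -/
noncomputable def trajectoryNoise {d n : ℕ} {Ξ Ω : Type*} [MeasurableSpace Ξ] (P : Schedule)
    (w : ℕ → Fin n) (lmo : Vec d → Vec d) (F : Vec d → Ξ → ℝ) (D : Measure Ξ) (x₀ m₀ : Vec d)
    (ξ : ℕ → Fin n → Ω → Ξ) (k : ℕ) (ω : Ω) : Vec d :=
  stochGrad F (lmoIterate P w lmo (stochGrad F) x₀ m₀ (fun j i => ξ j i ω) (acceptedOrigin P.R w k))
      (ξ (acceptedOrigin P.R w k) (acceptedWorker P.R w k) ω) -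
    gradient (objective F D)
      (lmoIterate P w lmo (stochGrad F) x₀ m₀ (fun j i => ξ j i ω) (acceptedOrigin P.R w k))

section TrajectoryNoise

variable {d n : ℕ} {Ξ Ω : Type*} [mΞ : MeasurableSpace Ξ] [MeasurableSpace Ω] {P : Schedule}
  {w : ℕ → Fin n} {lmo : Vec d → Vec d} {F : Vec d → Ξ → ℝ} {D : Measure Ξ}
  [IsProbabilityMeasure D] {σ : ℝ} {μ : Measure Ω} [IsProbabilityMeasure μ]
  {ξ : ℕ → Fin n → Ω → Ξ}

/-- The iterate at which a gradient is computed depends only on samples of other computations. -/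
theorem measurable_lmoIterate_others {Ω : Type*} {ξ : ℕ → Fin n → Ω → Ξ} (hR : ∀ k, 0 < P.R k) (hlmo : Measurable lmo)
    (hgrad : Measurable fun z : Vec d × Ξ => stochGrad F z.1 z.2) (x₀ m₀ : Vec d)
    {q : ℕ × Fin n} {j : ℕ}
    (hq : ∀ l < j, (acceptedOrigin P.R w l, acceptedWorker P.R w l) ≠ q) :
    Measurable[⨆ r ∈ ({q}ᶜ : Set (ℕ × Fin n)), MeasurableSpace.comap (ξ r.1 r.2) mΞ]
      fun ω => lmoIterate P w lmo (stochGrad F) x₀ m₀ (fun j i => ξ j i ω) j := by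
  -- The general measurability statement is used with the σ-algebra generated by the other samples
  -- in place of an ambient one.
  refine (@measurable_momentum_lmoIterate d n Ξ Ω mΞ
    (⨆ r ∈ ({q}ᶜ : Set (ℕ × Fin n)), MeasurableSpace.comap (ξ r.1 r.2) mΞ)
    P hR w lmo hlmo _ hgrad x₀ m₀ ξ j fun l hl => ?_).2 j le_rfl
  exact (comap_measurable _).mono (le_iSup₂_of_le
    (f := fun (r : ℕ × Fin n) (_ : r ∈ ({q}ᶜ : Set (ℕ × Fin n))) =>
      MeasurableSpace.comap (ξ r.1 r.2) mΞ) _ (hq l hl) le_rfl) le_rfl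

theorem measurable_lmoIterate (hR : ∀ k, 0 < P.R k) (hlmo : Measurable lmo)
    (hgrad : Measurable fun z : Vec d × Ξ => stochGrad F z.1 z.2) (x₀ m₀ : Vec d)
    (hξ : ∀ k i, Measurable (ξ k i)) (j : ℕ) :
    Measurable fun ω => lmoIterate P w lmo (stochGrad F) x₀ m₀ (fun j i => ξ j i ω) j :=
  (measurable_momentum_lmoIterate hR w hlmo hgrad x₀ m₀ j fun _ _ => hξ _ _).2 j le_rfl

theorem memLp_trajectoryNoise (hR : ∀ k, 0 < P.R k) (hlmo : Measurable lmo)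
    (hF : UnbiasedBoundedVariance F D σ) (x₀ m₀ : Vec d) (hξ : ∀ k i, Measurable (ξ k i))
    (hξD : ∀ k i, μ.map (ξ k i) = D) (hind : iIndepFun (fun q : ℕ × Fin n => ξ q.1 q.2) μ)
    (k : ℕ) : MemLp (trajectoryNoise P w lmo F D x₀ m₀ ξ k) 2 μ ∧
      ∫ ω, ‖trajectoryNoise P w lmo F D x₀ m₀ ξ k ω‖ ^ 2 ∂μ ≤ σ ^ 2 := by
  have hgrad := measurable_stochGrad hF.measurable_loss hF.differentiable_loss
  have hΦ : Measurable fun z : Vec d × Ξ =>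
      stochGrad F z.1 z.2 - gradient (objective F D) z.1 :=
    hgrad.sub ((measurable_gradient _).comp measurable_fst)
  refine memLp_two_of_indepFun hΦ hF.integrable_sq hF.variance_le
    (measurable_lmoIterate hR hlmo hgrad x₀ m₀ hξ _) (hξ _ _) (hξD _ _) ?_
  exact indepFun_of_measurable_iSup_compl (X := fun q : ℕ × Fin n => ξ q.1 q.2)
    (fun q => hξ q.1 q.2) hind (acceptedOrigin P.R w k, acceptedWorker P.R w k)
    (measurable_lmoIterate_others hR hlmo hgrad x₀ m₀ fun l hl =>
      accepted_ne_of_lt hR w (hl.trans_le (acceptedOrigin_le hR w k)))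

/-- The ordering is by origin, not by arrival, since gradients may arrive out of order. With the
earlier origin in `j`, both the noise `j` and the iterate at which gradient `k` is computed are
functions of samples other than that of `k`, so the noise `k` is centred given them. -/
theorem integral_inner_trajectoryNoise_of_le (hR : ∀ k, 0 < P.R k) (hlmo : Measurable lmo)
    (hF : UnbiasedBoundedVariance F D σ) (x₀ m₀ : Vec d) (hξ : ∀ k i, Measurable (ξ k i))
    (hξD : ∀ k i, μ.map (ξ k i) = D) (hind : iIndepFun (fun q : ℕ × Fin n => ξ q.1 q.2) μ)
    {j k : ℕ} (hjk : j ≠ k) (ho : acceptedOrigin P.R w j ≤ acceptedOrigin P.R w k) :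
    ∫ ω, ⟪trajectoryNoise P w lmo F D x₀ m₀ ξ j ω, trajectoryNoise P w lmo F D x₀ m₀ ξ k ω⟫_ℝ ∂μ
      = 0 := by
  have hgrad := measurable_stochGrad hF.measurable_loss hF.differentiable_loss
  have hΦ : Measurable fun z : Vec d × Ξ =>
      stochGrad F z.1 z.2 - gradient (objective F D) z.1 :=
    hgrad.sub ((measurable_gradient _).comp measurable_fst)
  have hne : (acceptedOrigin P.R w j, acceptedWorker P.R w j) ≠
      (acceptedOrigin P.R w k, acceptedWorker P.R w k) := by
    rcases lt_or_gt_of_ne hjk with h | h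
    · exact accepted_ne_of_lt hR w h
    · exact (accepted_ne_of_lt hR w h).symm
  have hY := measurable_lmoIterate hR (w := w) hlmo hgrad x₀ m₀ hξ
  have hZ := hΦ.comp ((hY (acceptedOrigin P.R w j)).prodMk
    (hξ (acceptedOrigin P.R w j) (acceptedWorker P.R w j)))
  have hothers : ∀ i ≤ acceptedOrigin P.R w k, Measurable[⨆ r ∈
      ({(acceptedOrigin P.R w k, acceptedWorker P.R w k)}ᶜ : Set (ℕ × Fin n)),
      MeasurableSpace.comap (ξ r.1 r.2) mΞ]
      fun ω => lmoIterate P w lmo (stochGrad F) x₀ m₀ (fun j i => ξ j i ω) i := fun i hi =>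
    measurable_lmoIterate_others hR hlmo hgrad x₀ m₀ fun l hl =>
      accepted_ne_of_lt hR w (hl.trans_le (hi.trans (acceptedOrigin_le hR w k)))
  have hξj : Measurable[⨆ r ∈
      ({(acceptedOrigin P.R w k, acceptedWorker P.R w k)}ᶜ : Set (ℕ × Fin n)),
      MeasurableSpace.comap (ξ r.1 r.2) mΞ]
      (ξ (acceptedOrigin P.R w j) (acceptedWorker P.R w j)) :=
    (comap_measurable _).mono (le_iSup₂_of_le
      (f := fun (r : ℕ × Fin n) (_ : r ∈
        ({(acceptedOrigin P.R w k, acceptedWorker P.R w k)}ᶜ : Set (ℕ × Fin n))) =>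
        MeasurableSpace.comap (ξ r.1 r.2) mΞ) _ hne le_rfl) le_rfl
  have hZo := hΦ.comp ((hothers _ ho).prodMk hξj)
  have hindk : IndepFun (fun ω => (trajectoryNoise P w lmo F D x₀ m₀ ξ j ω,
      lmoIterate P w lmo (stochGrad F) x₀ m₀ (fun j i => ξ j i ω) (acceptedOrigin P.R w k)))
      (ξ (acceptedOrigin P.R w k) (acceptedWorker P.R w k)) μ :=
    indepFun_of_measurable_iSup_compl (X := fun q : ℕ × Fin n => ξ q.1 q.2)
      (fun q => hξ q.1 q.2) hind (acceptedOrigin P.R w k, acceptedWorker P.R w k)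
      (hZo.prodMk (hothers _ le_rfl))
  have hmean : ∀ x, ∫ s, (stochGrad F x s - gradient (objective F D) x) ∂D = 0 := fun x => by
    rw [integral_sub (hF.integrable_grad x) (integrable_const _), hF.unbiased x]
    simp
  exact integral_inner_eq_zero_of_indepFun hΦ hF.integrable_sq hF.variance_le
    (fun x => (hF.integrable_grad x).sub (integrable_const (gradient (objective F D) x))) hmean
    (hY _) hZ (hξ _ _)
    (hξD _ _) hindk (memLp_trajectoryNoise hR hlmo hF x₀ m₀ hξ hξD hind j).1

theorem integral_inner_trajectoryNoise (hR : ∀ k, 0 < P.R k) (hlmo : Measurable lmo)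
    (hF : UnbiasedBoundedVariance F D σ) (x₀ m₀ : Vec d) (hξ : ∀ k i, Measurable (ξ k i))
    (hξD : ∀ k i, μ.map (ξ k i) = D) (hind : iIndepFun (fun q : ℕ × Fin n => ξ q.1 q.2) μ)
    (j k : ℕ) (hjk : j < k) :
    ∫ ω, ⟪trajectoryNoise P w lmo F D x₀ m₀ ξ j ω, trajectoryNoise P w lmo F D x₀ m₀ ξ k ω⟫_ℝ ∂μ
      = 0 := by
  rcases le_total (acceptedOrigin P.R w j) (acceptedOrigin P.R w k) with h | h
  · exact integral_inner_trajectoryNoise_of_le hR hlmo hF x₀ m₀ hξ hξD hind hjk.ne h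
  · simp only [real_inner_comm (trajectoryNoise P w lmo F D x₀ m₀ ξ k _)]
    exact integral_inner_trajectoryNoise_of_le hR hlmo hF x₀ m₀ hξ hξD hind hjk.ne' h

end TrajectoryNoise

/-! ### The expected gradient norms -/

theorem sqrtSchedule_alpha_le (k : ℕ) :
    (if k = 0 then 1 else 1 / √(k : ℝ)) ≤ (2 / quarterRoot (k + 1)) ^ 2 := by
  rw [div_pow, quarterRoot_sq]
  split_ifs with hk
  · simp [hk]
  · have hk1 : (1 : ℝ) ≤ k := by exact_mod_cast Nat.pos_of_ne_zero hk
    rw [div_le_div_iff₀ (by positivity) (by positivity), one_mul]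
    refine Real.sqrt_le_iff.2 ⟨by positivity, ?_⟩
    rw [mul_pow, Real.sq_sqrt (by positivity)]
    push_cast
    linarith

theorem lmoIterate_sqrtSchedule_succ {d n : ℕ} {Ξ : Type*} {w : ℕ → Fin n}
    {lmo : Vec d → Vec d} {F : Vec d → Ξ → ℝ} {h : ℝ} (x₀ m₀ : Vec d) (ζ : ℕ → Fin n → Ξ) (k : ℕ) :
    lmoIterate (sqrtSchedule h) w lmo (stochGrad F) x₀ m₀ ζ (k + 1) =
      lmoIterate (sqrtSchedule h) w lmo (stochGrad F) x₀ m₀ ζ k + (h / quarterRoot (k + 1) ^ 3) •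
        lmo (momentum (sqrtSchedule h) w lmo (stochGrad F) x₀ m₀ ζ (k + 1)) := by
  rw [lmoIterate_succ, sqrtSchedule_eta]

section Expectation

variable {d n : ℕ} {Ξ Ω : Type*} [MeasurableSpace Ξ] [MeasurableSpace Ω]
  {N : Seminorm ℝ (Vec d)} {w : ℕ → Fin n} {lmo : Vec d → Vec d} {F : Vec d → Ξ → ℝ}
  {D : Measure Ξ} {σ L₀ L₁ h fstar : ℝ} {μ : Measure Ω}
  [IsProbabilityMeasure μ] {ξ : ℕ → Fin n → Ω → Ξ}

theorem sum_gradient_trajectory_le {Ω : Type*} {ξ : ℕ → Fin n → Ω → Ξ} (hN : IsNorm N) (hlmo : IsLMO N lmo)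
    (hstar : ∀ x, fstar ≤ objective F D x) (hF : UnbiasedBoundedVariance F D σ) (h₀ : 0 ≤ L₀)
    (h₁ : 0 ≤ L₁) (hf : IsGenSmooth N (objective F D) L₀ L₁) (hh : 0 ≤ h) (x₀ m₀ : Vec d) (ω : Ω)
    (K : ℕ) :
    8 / 15 * ∑ k ∈ Finset.range K, h / quarterRoot (k + 1) ^ 3 *
        dualNorm N (gradient (objective F D)
          (lmoIterate (sqrtSchedule h) w lmo (stochGrad F) x₀ m₀ (fun j i => ξ j i ω) k)) ≤
      (objective F D x₀ - fstar) + 2 * ∑ k ∈ Finset.range K, h / quarterRoot (k + 1) ^ 3 *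
        dualNorm N (noiseAverage (fun k => 1 / √(k : ℝ))
          (fun j => trajectoryNoise (sqrtSchedule h) w lmo F D x₀ m₀ ξ j ω) k) +
      8 * h ^ 2 * L₀ * (1 + Real.log K) + 7 * h ^ 2 * (17 * (L₁ * h)) ^ 4 *
        (modulus N (objective F D) L₀ L₁ x₀ * Real.exp (8 / 17 * (17 * (L₁ * h)) ^ 2)) := by
  have hR := sqrtSchedule_R_pos h
  refine sum_gradient_le hN h₀ h₁ hf hF.differentiable_objective hlmo hh hstar
    (x := lmoIterate (sqrtSchedule h) w lmo (stochGrad F) x₀ m₀ (fun j i => ξ j i ω))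
    (m := momentum (sqrtSchedule h) w lmo (stochGrad F) x₀ m₀ (fun j i => ξ j i ω))
    (o := acceptedOrigin (sqrtSchedule h).R w) (lmoIterate_sqrtSchedule_succ x₀ m₀ _)
    (fun k => ?_) (fun k => acceptedOrigin_le hR w _) ?_ (fun k => ?_) K
  · have := (serverLog_acceptedArrival hR w (k + 1)).2.2
    simpa [sqrtSchedule] using this
  -- Since α₀ = αinit = 1, the initial momentum `m₀` is forgotten, and the first accepted gradient
  -- is taken at x₀. The initial bias therefore vanishes.
  · have h1 := momentum_succ (sqrtSchedule h) w lmo (stochGrad F) x₀ m₀ (fun j i => ξ j i ω) hR 0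
    have h2 : acceptedOrigin (sqrtSchedule h).R w 0 = 0 :=
      Nat.le_zero.1 (acceptedOrigin_le hR w 0)
    rw [zero_add] at h1
    rw [h1, noiseAverage, trajectoryNoise, h2]
    simp [sqrtSchedule]
  · have h1 := momentum_succ (sqrtSchedule h) w lmo (stochGrad F) x₀ m₀ (fun j i => ξ j i ω) hR
      (k + 1)
    have hα : (sqrtSchedule h).α (k + 1) = 1 / √((k + 1 : ℕ) : ℝ) := by simp [sqrtSchedule]
    rw [if_neg (Nat.succ_ne_zero k), hα] at h1
    rw [h1, noiseAverage, trajectoryNoise]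
    module

/-- The distance from x₀ is bounded independently of the samples, so exponential growth bounds the
gradient norm by a constant. -/
theorem integrable_dualNorm_gradient (hN : IsNorm N) (hlmo : IsLMO N lmo) (hlm : Measurable lmo)
    (hF : UnbiasedBoundedVariance F D σ) (h₀ : 0 ≤ L₀) (h₁ : 0 ≤ L₁)
    (hf : IsGenSmooth N (objective F D) L₀ L₁) (hh : 0 ≤ h) (x₀ m₀ : Vec d)
    (hξ : ∀ k i, Measurable (ξ k i)) (k : ℕ) :
    Integrable (fun ω => dualNorm N (gradient (objective F D)
      (lmoIterate (sqrtSchedule h) w lmo (stochGrad F) x₀ m₀ (fun j i => ξ j i ω) k))) μ := by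
  have hgrad := measurable_stochGrad hF.measurable_loss hF.differentiable_loss
  have hm := hN.continuous_dualNorm.measurable.comp ((measurable_gradient (objective F D)).comp
    (measurable_lmoIterate (sqrtSchedule_R_pos h) (w := w) hlm hgrad x₀ m₀ hξ k))
  set r := h * ∑ j ∈ Finset.range k, 1 / quarterRoot (j + 1) ^ 3 with hr
  refine (integrable_const (dualNorm N (gradient (objective F D) x₀) +
    modulus N (objective F D) L₀ L₁ x₀ * r * Real.exp (2 * (L₁ * r)))).mono'
    hm.aestronglyMeasurable (Filter.Eventually.of_forall fun ω => ?_)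
  rw [Real.norm_of_nonneg (hN.dualNorm_nonneg _)]
  set x := lmoIterate (sqrtSchedule h) w lmo (stochGrad F) x₀ m₀ (fun j i => ξ j i ω) with hx
  have h1 := seminorm_iterate_sub_le hlmo hh (x := x)
    (lmoIterate_sqrtSchedule_succ x₀ m₀ fun j i => ξ j i ω) k
  rw [show x 0 = x₀ from rfl, ← hr] at h1
  have h2 := (hf.exp_growth hN h₁ h₀ x₀ (x k)).2
  have h3 := hN.dualNorm_add_le (gradient (objective F D) x₀)
    (gradient (objective F D) (x k) - gradient (objective F D) x₀)
  rw [add_sub_cancel] at h3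
  have ha := modulus_nonneg hN (objective F D) h₀ h₁ x₀
  have hr0 : 0 ≤ r := (apply_nonneg N _).trans h1
  refine h3.trans (add_le_add_right (h2.trans ?_) _)
  gcongr

theorem integral_dualNorm_noiseAverage_le [IsProbabilityMeasure D] (hN : IsNorm N) (hlm : Measurable lmo) (hσ : 0 ≤ σ)
    (hF : UnbiasedBoundedVariance F D σ) (x₀ m₀ : Vec d) (hξ : ∀ k i, Measurable (ξ k i))
    (hξD : ∀ k i, μ.map (ξ k i) = D) (hind : iIndepFun (fun q : ℕ × Fin n => ξ q.1 q.2) μ)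
    (k : ℕ) :
    Integrable (fun ω => dualNorm N (noiseAverage (fun k => 1 / √(k : ℝ))
        (fun j => trajectoryNoise (sqrtSchedule h) w lmo F D x₀ m₀ ξ j ω) k)) μ ∧
      ∫ ω, dualNorm N (noiseAverage (fun k => 1 / √(k : ℝ))
        (fun j => trajectoryNoise (sqrtSchedule h) w lmo F D x₀ m₀ ξ j ω) k) ∂μ ≤
      normConst N * σ * (2 / quarterRoot (k + 1)) := by
  have hR := sqrtSchedule_R_pos h
  have hq := quarterRoot_succ_pos k
  have hnoise := memLp_trajectoryNoise hR (w := w) hlm hF x₀ m₀ hξ hξD hind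
  have horth := integral_inner_trajectoryNoise hR (w := w) hlm hF x₀ m₀ hξ hξD hind
  have hV := memLp_noiseAverage (fun k => 1 / √(k : ℝ)) (fun k => (hnoise k).1) k
  have h1 := integral_noiseAverage_sq_le (fun k => (hnoise k).1) horth (fun k => (hnoise k).2) k
  have h2 := integral_norm_le_of_integral_sq_le (c := σ * (2 / quarterRoot (k + 1))) hV
    (by positivity) (h1.trans (by
      rw [mul_pow]
      exact mul_le_mul_of_nonneg_left (sqrtSchedule_alpha_le k) (sq_nonneg σ)))
  have hVint : Integrable (fun ω => ‖noiseAverage (fun k => 1 / √(k : ℝ))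
      (fun j => trajectoryNoise (sqrtSchedule h) w lmo F D x₀ m₀ ξ j ω) k‖) μ :=
    (hV.integrable one_le_two).norm
  have hint : Integrable (fun ω => dualNorm N (noiseAverage (fun k => 1 / √(k : ℝ))
        (fun j => trajectoryNoise (sqrtSchedule h) w lmo F D x₀ m₀ ξ j ω) k)) μ := by
    refine (hVint.const_mul (normConst N)).mono'
      (hN.continuous_dualNorm.comp_aestronglyMeasurable hV.1)
      (Filter.Eventually.of_forall fun ω => ?_)
    rw [Real.norm_of_nonneg (hN.dualNorm_nonneg _)]
    exact hN.dualNorm_le_normConst_mul _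
  refine ⟨hint, (integral_mono hint (hVint.const_mul _)
    fun ω => hN.dualNorm_le_normConst_mul _).trans ?_⟩
  rw [integral_const_mul, mul_assoc]
  exact mul_le_mul_of_nonneg_left h2 hN.normConst_nonneg

theorem sum_integral_dualNorm_gradient_le [IsProbabilityMeasure D] (hN : IsNorm N) (hlmo : IsLMO N lmo)
    (hlm : Measurable lmo) (hstar : ∀ x, fstar ≤ objective F D x) (hσ : 0 ≤ σ)
    (hF : UnbiasedBoundedVariance F D σ) (h₀ : 0 ≤ L₀) (h₁ : 0 ≤ L₁)
    (hf : IsGenSmooth N (objective F D) L₀ L₁) (hh : 0 ≤ h) (x₀ m₀ : Vec d)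
    (hξ : ∀ k i, Measurable (ξ k i)) (hξD : ∀ k i, μ.map (ξ k i) = D)
    (hind : iIndepFun (fun q : ℕ × Fin n => ξ q.1 q.2) μ) (K : ℕ) :
    8 / 15 * ∑ k ∈ Finset.range K, h / quarterRoot (k + 1) ^ 3 *
        ∫ ω, dualNorm N (gradient (objective F D)
          (lmoIterate (sqrtSchedule h) w lmo (stochGrad F) x₀ m₀ (fun j i => ξ j i ω) k)) ∂μ ≤
      (objective F D x₀ - fstar) + 4 * h * (normConst N * σ) * (1 + Real.log K) +
      8 * h ^ 2 * L₀ * (1 + Real.log K) + 7 * h ^ 2 * (17 * (L₁ * h)) ^ 4 *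
        (modulus N (objective F D) L₀ L₁ x₀ * Real.exp (8 / 17 * (17 * (L₁ * h)) ^ 2)) := by
  have hG := integrable_dualNorm_gradient (w := w) (μ := μ) hN hlmo hlm hF h₀ h₁ hf hh x₀ m₀ hξ
  have hV := integral_dualNorm_noiseAverage_le (w := w) (h := h) hN hlm hσ hF x₀ m₀ hξ hξD hind
  have hpath := fun ω => sum_gradient_trajectory_le (w := w) (ξ := ξ) hN hlmo hstar hF h₀ h₁ hf hh
    x₀ m₀ ω K
  have hVint := integrable_finsetSum (Finset.range K) fun k _ =>
    (hV k).1.const_mul (h / quarterRoot (k + 1) ^ 3)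
  have hGint := integrable_finsetSum (Finset.range K) fun k _ =>
    (hG k).const_mul (h / quarterRoot (k + 1) ^ 3)
  have hsum : ∑ k ∈ Finset.range K, h / quarterRoot (k + 1) ^ 3 *
      ∫ ω, dualNorm N (noiseAverage (fun k => 1 / √(k : ℝ))
        (fun j => trajectoryNoise (sqrtSchedule h) w lmo F D x₀ m₀ ξ j ω) k) ∂μ ≤
      2 * h * (normConst N * σ) * (1 + Real.log K) := by
    calc _ ≤ ∑ k ∈ Finset.range K, 2 * h * (normConst N * σ) * (1 / ((k : ℝ) + 1)) := by
          refine Finset.sum_le_sum fun k _ => ?_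
          have hq := quarterRoot_succ_pos k
          have hq4 := quarterRoot_pow_four (k + 1)
          push_cast at hq4
          rw [← hq4]
          -- The stepsize h/q³ times the noise level 2ρσ/q is 2hρσ/(k+1), hence a harmonic sum.
          refine (mul_le_mul_of_nonneg_left (hV k).2 (by positivity)).trans (le_of_eq ?_)
          field_simp
      _ = 2 * h * (normConst N * σ) * ∑ k ∈ Finset.range K, (1 / ((k : ℝ) + 1)) := by
          rw [Finset.mul_sum]
      _ ≤ _ := by
          have := hN.normConst_nonneg
          exact mul_le_mul_of_nonneg_left (sum_inv_succ_le_one_add_log K) (by positivity)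
  have hmono := integral_mono (hGint.const_mul (8 / 15))
    ((((integrable_const (objective F D x₀ - fstar)).add (hVint.const_mul 2)).add
      (integrable_const _)).add (integrable_const _)) hpath
  have e1 := integral_add (((integrable_const (μ := μ) (objective F D x₀ - fstar)).add
    (hVint.const_mul 2)).add (integrable_const (8 * h ^ 2 * L₀ * (1 + Real.log K))))
    (integrable_const (7 * h ^ 2 * (17 * (L₁ * h)) ^ 4 *
        (modulus N (objective F D) L₀ L₁ x₀ * Real.exp (8 / 17 * (17 * (L₁ * h)) ^ 2))))
  have e2 := integral_add ((integrable_const (μ := μ) (objective F D x₀ - fstar)).add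
    (hVint.const_mul 2)) (integrable_const (8 * h ^ 2 * L₀ * (1 + Real.log K)))
  have e3 := integral_add (integrable_const (μ := μ) (objective F D x₀ - fstar))
    (hVint.const_mul 2)
  rw [integral_const_mul, integral_finsetSum _ fun k _ => (hG k).const_mul _] at hmono
  simp only [integral_const_mul] at hmono
  refine hmono.trans ?_
  simp only [Pi.add_apply] at e1 e2 e3
  refine (e1.trans (congrArg₂ _ (e2.trans (congrArg₂ _ e3 rfl)) rfl)).le.trans ?_
  rw [integral_const_mul, integral_finsetSum _ fun k _ => (hV k).1.const_mul _]
  simp only [integral_const_mul, integral_const, probReal_univ, one_smul]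
  linarith

end Expectation

/-! ### The iteration complexity -/

/-- Since 8/17 < 1, the leftover exponential e^{9u/17} absorbs the powers of u. With u = (17L₁h)²
these powers come from the number of long steps and, for the cube, the factor L₁²h². -/
theorem cube_mul_exp_le {u : ℝ} (hu : 0 ≤ u) :
    u ^ 3 * Real.exp (8 / 17 * u) ≤ 41 * Real.exp u ∧
      u ^ 2 * Real.exp (8 / 17 * u) ≤ 8 * Real.exp u := by
  have hE : Real.exp u = Real.exp (9 / 17 * u) * Real.exp (8 / 17 * u) := by
    rw [← Real.exp_add]; congr 1; ring
  have h3 := Real.pow_div_factorial_le_exp (9 / 17 * u) (by positivity) 3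
  have h2 := Real.pow_div_factorial_le_exp (9 / 17 * u) (by positivity) 2
  norm_num [Nat.factorial] at h2 h3
  rw [hE, ← mul_assoc, ← mul_assoc]
  constructor
  · refine mul_le_mul_of_nonneg_right ?_ (Real.exp_pos _).le
    have : 0 ≤ u ^ 3 := by positivity
    nlinarith
  · refine mul_le_mul_of_nonneg_right ?_ (Real.exp_pos _).le
    have : 0 ≤ u ^ 2 := by positivity
    nlinarith

/-- The contribution of the steps that are long compared with `1 / L₁`. -/
theorem long_step_error_le {L₀ L₁ h Δ a : ℝ} (h₀ : 0 ≤ L₀) (hΔ : 0 ≤ Δ)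
    (ha : a ≤ 10 * L₁ ^ 2 * Δ + 2 * L₀) :
    7 * h ^ 2 * (17 * (L₁ * h)) ^ 4 * (a * Real.exp (8 / 17 * (17 * (L₁ * h)) ^ 2)) ≤
      Real.exp ((17 * (L₁ * h)) ^ 2) * (11 * Δ + 112 * (h ^ 2 * L₀)) := by
  set A := 17 * (L₁ * h) with hA
  obtain ⟨h3, h2⟩ := cube_mul_exp_le (sq_nonneg A)
  set E := Real.exp (8 / 17 * A ^ 2) with hE
  set E' := Real.exp (A ^ 2) with hE'
  have hE0 : 0 ≤ E := (Real.exp_pos _).le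
  have hE0' : 0 ≤ E' := (Real.exp_pos _).le
  have e1 : 7 * h ^ 2 * A ^ 4 * ((10 * L₁ ^ 2 * Δ + 2 * L₀) * E) =
      70 / 289 * Δ * ((A ^ 2) ^ 3 * E) + 14 * (h ^ 2 * L₀) * ((A ^ 2) ^ 2 * E) := by
    rw [hA]; ring
  calc _ ≤ 7 * h ^ 2 * A ^ 4 * ((10 * L₁ ^ 2 * Δ + 2 * L₀) * E) := by gcongr
    _ ≤ 70 / 289 * Δ * (41 * E') + 14 * (h ^ 2 * L₀) * (8 * E') := by
        rw [e1]
        gcongr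
    _ ≤ _ := by
        have := mul_nonneg hΔ hE0'
        linarith

theorem IsStepsizeChoice.pos {L₀ L₁ Δ ρσ h Ψ : ℝ} (hc : IsStepsizeChoice L₀ L₁ Δ ρσ h Ψ) :
    0 < h := by
  rcases hc with ⟨-, η, hη, rfl, -⟩ | ⟨-, η, hη, rfl, -⟩ | ⟨hL, rfl, -⟩ <;> positivity

theorem IsStepsizeChoice.nonneg {L₀ L₁ Δ ρσ h Ψ : ℝ} (hc : IsStepsizeChoice L₀ L₁ Δ ρσ h Ψ)
    (h₀ : 0 ≤ L₀) (hΔ : 0 ≤ Δ) (hρσ : 0 ≤ ρσ) : 0 ≤ Ψ := by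
  rcases hc with ⟨-, η, hη, -, rfl⟩ | ⟨-, η, hη, -, rfl⟩ | ⟨hL, -, rfl⟩ <;> positivity

/-- The constant is 51 = 3·17: the 17 compensates the division by 17 in `h`, and 3 bounds e in the
third choice, where 17L₁h = 1. -/
theorem IsStepsizeChoice.error_le {L₀ L₁ Δ ρσ h Ψ : ℝ} (hc : IsStepsizeChoice L₀ L₁ Δ ρσ h Ψ)
    (h₀ : 0 ≤ L₀) (hΔ : 0 ≤ Δ) (hρσ : 0 ≤ ρσ) :
    Real.exp ((17 * (L₁ * h)) ^ 2) * (Δ + h ^ 2 * L₀) + h * ρσ ≤ 51 * (h * Ψ) := by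
  rcases hc with ⟨rfl, η, hη, rfl, rfl⟩ | ⟨hL, η, hη, rfl, rfl⟩ | ⟨hL, rfl, rfl⟩
  · have e : h * (Δ / h + ρσ + L₀ * h) = Δ + h * ρσ + h ^ 2 * L₀ := by field_simp
    rw [e]
    simp only [zero_mul, mul_zero, ne_eq, OfNat.ofNat_ne_zero, not_false_eq_true, zero_pow,
      Real.exp_zero, one_mul]
    have : 0 ≤ h * ρσ := by positivity
    have : 0 ≤ h ^ 2 * L₀ := by positivity
    linarith
  · rw [show (17 * (L₁ * (η / 17))) ^ 2 = L₁ ^ 2 * η ^ 2 by ring]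
    set E := Real.exp (L₁ ^ 2 * η ^ 2)
    have hE : 0 ≤ E := (Real.exp_pos _).le
    have e : 51 * (η / 17 * (E * (Δ / η) + ρσ + E * L₀ * η)) =
        3 * (E * Δ) + 3 * (η * ρσ) + 3 * (E * (η ^ 2 * L₀)) := by
      field_simp
      ring
    rw [e]
    have : 0 ≤ E * Δ := by positivity
    have : 0 ≤ η * ρσ := by positivity
    have : 0 ≤ E * (η ^ 2 * L₀) := by positivity
    linarith
  · rw [show (17 * (L₁ * (1 / (17 * L₁)))) ^ 2 = 1 by field_simp]
    have hE : Real.exp 1 ≤ 3 := by linarith [Real.exp_one_lt_d9]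
    have e : 51 * (1 / (17 * L₁) * (L₁ * Δ + ρσ + L₀ / L₁)) =
        3 * (Δ + 289 * ((1 / (17 * L₁)) ^ 2 * L₀)) + 51 * (1 / (17 * L₁) * ρσ) := by
      field_simp
      ring
    rw [e]
    have h1 : 0 ≤ (1 / (17 * L₁)) ^ 2 * L₀ := by positivity
    have h2 : 0 ≤ 1 / (17 * L₁) * ρσ := by positivity
    have h3 := mul_le_mul_of_nonneg_right hE (add_nonneg hΔ h1)
    linarith

/-- If all of the first `K` iterates are far from stationary, then `K` is small. -/
theorem quarterRoot_mul_le_of_forall_lt {d n : ℕ} {Ξ Ω : Type*} [MeasurableSpace Ξ]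
    [MeasurableSpace Ω] {N : Seminorm ℝ (Vec d)} {w : ℕ → Fin n} {lmo : Vec d → Vec d}
    {F : Vec d → Ξ → ℝ} {D : Measure Ξ} [IsProbabilityMeasure D] {σ L₀ L₁ h fstar : ℝ}
    {μ : Measure Ω} [IsProbabilityMeasure μ] {ξ : ℕ → Fin n → Ω → Ξ} (hN : IsNorm N)
    (hlmo : IsLMO N lmo) (hlm : Measurable lmo) (hstar : ∀ x, fstar ≤ objective F D x)
    (hσ : 0 ≤ σ) (hF : UnbiasedBoundedVariance F D σ) (h₀ : 0 ≤ L₀) (h₁ : 0 ≤ L₁)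
    (hf : IsGenSmooth N (objective F D) L₀ L₁) (x₀ m₀ : Vec d)
    (hξ : ∀ k i, Measurable (ξ k i)) (hξD : ∀ k i, μ.map (ξ k i) = D)
    (hind : iIndepFun (fun q : ℕ × Fin n => ξ q.1 q.2) μ) {Ψ ε : ℝ}
    (hc : IsStepsizeChoice L₀ L₁ (objective F D x₀ - fstar) (normConst N * σ) h Ψ) {K : ℕ}
    (hK : ∀ k < K, ¬ IsEpsStationary μ N (objective F D) ε (fun ω =>
      lmoIterate (sqrtSchedule h) w lmo (stochGrad F) x₀ m₀ (fun j i => ξ j i ω) k)) :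
    quarterRoot K * ε ≤ 12000 * Ψ * (1 + Real.log K) := by
  have hh := hc.pos
  have hΔ : 0 ≤ objective F D x₀ - fstar := sub_nonneg.2 (hstar x₀)
  have hρσ : 0 ≤ normConst N * σ := mul_nonneg hN.normConst_nonneg hσ
  have hlog : 0 ≤ Real.log K := Real.log_natCast_nonneg K
  have hmain := sum_integral_dualNorm_gradient_le (w := w) hN hlmo hlm hstar hσ hF h₀ h₁ hf hh.le
    x₀ m₀ hξ hξD hind K
  have hlong := long_step_error_le (h := h) h₀ hΔ
    (hf.modulus_le hN h₁ h₀ hF.differentiable_objective hlmo hstar x₀)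
  have herr := hc.error_le h₀ hΔ hρσ
  have hbig : ∀ k ∈ Finset.range K, h * ε * (1 / quarterRoot (k + 1) ^ 3) ≤
      h / quarterRoot (k + 1) ^ 3 * ∫ ω, dualNorm N (gradient (objective F D)
        (lmoIterate (sqrtSchedule h) w lmo (stochGrad F) x₀ m₀ (fun j i => ξ j i ω) k)) ∂μ := by
    intro k hk
    have hq := quarterRoot_succ_pos k
    have h2 : ε ≤ ∫ ω, dualNorm N (gradient (objective F D)
        (lmoIterate (sqrtSchedule h) w lmo (stochGrad F) x₀ m₀ (fun j i => ξ j i ω) k)) ∂μ := by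
      -- Failure of stationarity cannot be due to non-integrability, so it means that the
      -- expectation exceeds ε.
      by_contra! hlt
      exact hK k (Finset.mem_range.1 hk)
        ⟨integrable_dualNorm_gradient hN hlmo hlm hF h₀ h₁ hf hh.le x₀ m₀ hξ k, hlt.le⟩
    calc _ = h / quarterRoot (k + 1) ^ 3 * ε := by ring
      _ ≤ _ := by gcongr
  rcases le_or_gt ε 0 with hε | hε
  · have hΨ := hc.nonneg h₀ hΔ hρσ
    exact (mul_nonpos_of_nonneg_of_nonpos (quarterRoot_nonneg K) hε).trans (by positivity)
  have hsum := Finset.sum_le_sum hbig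
  rw [← Finset.mul_sum] at hsum
  have h1 : h * ε * quarterRoot K ≤ h * ε * ∑ k ∈ Finset.range K, 1 / quarterRoot (k + 1) ^ 3 := by
    gcongr
    exact quarterRoot_le_sum K
  set Δ := objective F D x₀ - fstar
  set E := Real.exp ((17 * (L₁ * h)) ^ 2)
  have hE1 : 1 ≤ E := Real.one_le_exp (sq_nonneg _)
  have h2 : Δ ≤ E * Δ := le_mul_of_one_le_left hΔ hE1
  have hhL : 0 ≤ h ^ 2 * L₀ := by positivity
  have h3 : h ^ 2 * L₀ ≤ E * (h ^ 2 * L₀) := le_mul_of_one_le_left hhL hE1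
  have hl : 1 ≤ 1 + Real.log K := by linarith
  have h4 : E * Δ ≤ E * Δ * (1 + Real.log K) := le_mul_of_one_le_right (by positivity) hl
  have h5 : E * (h ^ 2 * L₀) ≤ E * (h ^ 2 * L₀) * (1 + Real.log K) :=
    le_mul_of_one_le_right (by positivity) hl
  have h6 : h ^ 2 * L₀ * (1 + Real.log K) ≤ E * (h ^ 2 * L₀) * (1 + Real.log K) := by gcongr
  have h7 := mul_le_mul_of_nonneg_right herr (zero_le_one.trans hl)
  have h8 : 0 ≤ h * (normConst N * σ) * (1 + Real.log K) := by positivity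
  -- The largest coefficient is 8 + 112 = 120, that of h²L₀, and 120·51·15/8 = 11475 ≤ 12000.
  have h9 : 8 / 15 * (h * (quarterRoot K * ε)) ≤
      8 / 15 * (h * (12000 * Ψ * (1 + Real.log K))) := by
    have h10 : 0 ≤ h * Ψ * (1 + Real.log K) := by
      have hΨ := hc.nonneg h₀ hΔ hρσ
      positivity
    linarith
  exact le_of_mul_le_mul_left (le_of_mul_le_mul_left h9 (by norm_num)) hh

/-! ### Inverting the inequality K^{1/4} ≤ c r (1 + log K). -/

theorem one_add_log_le_sqrt_quarterRoot {K : ℕ} (hK : 1 ≤ K) :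
    1 + Real.log K ≤ 8 * √(quarterRoot K) ∧ Real.log K = 8 * Real.log √(quarterRoot K) := by
  have hq := one_le_quarterRoot hK
  have hs : 0 < √(quarterRoot K) := Real.sqrt_pos.2 (by linarith)
  have h1 : Real.log K = 8 * Real.log √(quarterRoot K) := by
    rw [← quarterRoot_pow_four K, Real.log_pow, Real.log_sqrt (by linarith)]
    push_cast
    ring
  refine ⟨?_, h1⟩
  have := Real.log_le_sub_one_of_pos hs
  linarith

/-- Two passes: the crude bound 1 + log K ≤ 8K^{1/8} first gives K^{1/8} ≤ 8cr, hence log K = O(1 +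
log(1 + r)); inserting this into the hypothesis gives the sharp power of r. -/
theorem exists_natCast_le_of_quarterRoot_le {c : ℝ} (hc : 1 ≤ c) :
    ∃ C : ℝ, 0 < C ∧ ∀ r : ℝ, 0 ≤ r → ∀ K : ℕ, 1 ≤ K →
      quarterRoot K ≤ c * r * (1 + Real.log K) → (K : ℝ) ≤ C * (r ^ 4 * (1 + Real.log (1 + r)) ^ 4) := by
  have hlc : 0 ≤ Real.log (8 * c) := Real.log_nonneg (by linarith)
  refine ⟨(c * (9 + 8 * Real.log (8 * c))) ^ 4, by positivity, fun r hr K hK h => ?_⟩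
  have hlr : 0 ≤ Real.log (1 + r) := Real.log_nonneg (by linarith)
  obtain ⟨h1, h2⟩ := one_add_log_le_sqrt_quarterRoot hK
  have hq := one_le_quarterRoot hK
  have hs1 : 1 ≤ √(quarterRoot K) := Real.one_le_sqrt.2 hq
  have hsq : √(quarterRoot K) * √(quarterRoot K) = quarterRoot K :=
    Real.mul_self_sqrt (by linarith)
  have h3 : √(quarterRoot K) ≤ 8 * c * r := by
    have : √(quarterRoot K) * √(quarterRoot K) ≤ (8 * c * r) * √(quarterRoot K) := by
      rw [hsq]
      calc _ ≤ _ := h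
        _ ≤ c * r * (8 * √(quarterRoot K)) := by gcongr
        _ = _ := by ring
    exact le_of_mul_le_mul_right this (by linarith)
  have hr0 : 0 < r := by
    rcases eq_or_lt_of_le hr with h0 | h0
    · rw [← h0] at h3; linarith
    · exact h0
  have h4 : Real.log √(quarterRoot K) ≤ Real.log (8 * c) + Real.log (1 + r) := by
    rw [← Real.log_mul (by positivity) (by positivity)]
    refine Real.log_le_log (by linarith) (h3.trans ?_)
    gcongr
    linarith
  have h5 : 1 + Real.log K ≤ (9 + 8 * Real.log (8 * c)) * (1 + Real.log (1 + r)) := by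
    rw [h2]
    nlinarith [mul_nonneg hlc hlr]
  have h6 : quarterRoot K ≤ c * (9 + 8 * Real.log (8 * c)) * (r * (1 + Real.log (1 + r))) :=
    calc _ ≤ _ := h
      _ ≤ c * r * ((9 + 8 * Real.log (8 * c)) * (1 + Real.log (1 + r))) := by gcongr
      _ = _ := by ring
  calc (K : ℝ) = quarterRoot K ^ 4 := (quarterRoot_pow_four K).symm
    _ ≤ (c * (9 + 8 * Real.log (8 * c)) * (r * (1 + Real.log (1 + r)))) ^ 4 := by gcongr
    _ = _ := by ring

theorem three_mul_natSqrt_add_one_le {C y : ℝ} (hC : 0 < C) (hy : 0 ≤ y) {K : ℕ}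
    (hK : (K : ℝ) ≤ 1 + C * y ^ 2) :
    ((3 * Nat.sqrt K + 1 : ℕ) : ℝ) ≤ (4 + 3 * C) * (1 + y) := by
  have h1 : (Nat.sqrt K : ℝ) ≤ 1 + (1 + C) * y := by
    refine Real.nat_sqrt_le_real_sqrt.trans (Real.sqrt_le_iff.2 ⟨by positivity, hK.trans ?_⟩)
    have : 0 ≤ C * y := by positivity
    have : 0 ≤ C ^ 2 * y ^ 2 := by positivity
    have : 0 ≤ C * y ^ 2 := by positivity
    nlinarith [sq_nonneg y]
  push_cast
  linarith

theorem mainTheorem5 :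
    ∃ C : ℝ, 0 < C ∧
      ∀ (d n : ℕ) (Ξ : Type*) [MeasurableSpace Ξ] (Ω : Type*) [MeasurableSpace Ω]
        -- the norm and its linear minimization oracle
        (N : Seminorm ℝ (Vec d)) (_ : IsNorm N)
        (lmo : Vec d → Vec d) (_ : IsLMO N lmo) (_ : Measurable lmo)
        -- the stochastic objective
        (D : Measure Ξ) [IsProbabilityMeasure D] (F : Vec d → Ξ → ℝ)
        (x₀ m₀ : Vec d) (fstar σ L₀ L₁ : ℝ)
        (_ : ∀ x, fstar ≤ objective F D x)
        (_ : 0 ≤ σ) (_ : UnbiasedBoundedVariance F D σ)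
        (_ : 0 ≤ L₀) (_ : 0 ≤ L₁) (_ : IsGenSmooth N (objective F D) L₀ L₁)
        -- the i.i.d. samples: `ξ k i` is used by worker `i` for its computation at `x_k`
        (μ : Measure Ω) [IsProbabilityMeasure μ] (ξ : ℕ → Fin n → Ω → Ξ)
        (_ : ∀ k i, Measurable (ξ k i)) (_ : ∀ k i, μ.map (ξ k i) = D)
        (_ : iIndepFun (fun q : ℕ × Fin n => ξ q.1 q.2) μ)
        -- the universal computation model
        (p : Fin n → ℝ → ℝ) (_ : ∀ i, IsComputationRate (p i))
        (w : ℕ → Fin n) (_ : IsArrivalOrder p w)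
        -- the parameters and the accuracy
        (h Ψ : ℝ)
        (_ : IsStepsizeChoice L₀ L₁ (objective F D x₀ - fstar) (normConst N * σ) h Ψ)
        (ε : ℝ) (_ : 0 < ε),
        ∃ K : ℕ,
          -- `K = K_ε` is the number of iterations needed to reach an `ε`-stationary point
          IsLeast {K : ℕ | 1 ≤ K ∧ ∃ k < K, IsEpsStationary μ N (objective F D) ε
            (fun ω => lmoIterate (sqrtSchedule h) w lmo (stochGrad F) x₀ m₀
              (fun j i => ξ j i ω) k)} K ∧
          (K : ℝ) ≤ C * (1 + (Ψ / ε) ^ 4 * (1 + Real.log (1 + Ψ / ε)) ^ 4) ∧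
          updateTime (sqrtSchedule h).R p w K ≤ timeBound p (3 * Nat.sqrt K + 1) ∧
          ((3 * Nat.sqrt K + 1 : ℕ) : ℝ) ≤
            C * (1 + (Ψ / ε) ^ 2 * (1 + Real.log (1 + Ψ / ε)) ^ 2) := by
  obtain ⟨C, hC, hbound⟩ := exists_natCast_le_of_quarterRoot_le (c := 12000) (by norm_num)
  refine ⟨4 + 3 * C, by positivity, ?_⟩
  intro d n Ξ _ Ω _ N hN lmo hlmo hlm D _ F x₀ m₀ fstar σ L₀ L₁ hstar hσ hF h₀ h₁ hf μ _ ξ hξ hξD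
    hind p hp w hw h Ψ hc ε hε
  have hΨ := hc.nonneg h₀ (sub_nonneg.2 (hstar x₀)) (mul_nonneg hN.normConst_nonneg hσ)
  set r := Ψ / ε with hr
  have hr0 : 0 ≤ r := div_nonneg hΨ hε.le
  have hl : 0 ≤ Real.log (1 + r) := Real.log_nonneg (by linarith)
  set S := {K : ℕ | 1 ≤ K ∧ ∃ k < K, IsEpsStationary μ N (objective F D) ε
    (fun ω => lmoIterate (sqrtSchedule h) w lmo (stochGrad F) x₀ m₀ (fun j i => ξ j i ω) k)} with hS
  have hnot : ∀ K, 1 ≤ K → K ∉ S → (K : ℝ) ≤ C * (r ^ 4 * (1 + Real.log (1 + r)) ^ 4) := by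
    intro K hK hKS
    refine hbound r hr0 K hK ?_
    have h1 := quarterRoot_mul_le_of_forall_lt (w := w) hN hlmo hlm hstar hσ hF h₀ h₁ hf x₀ m₀ hξ
      hξD hind hc (K := K) (ε := ε) (fun k hk hst => hKS ⟨hK, k, hk, hst⟩)
    rw [← le_div_iff₀ hε] at h1
    exact h1.trans (le_of_eq (by rw [hr]; ring))
  have hne : S.Nonempty := by
    by_contra hemp
    rw [Set.not_nonempty_iff_eq_empty] at hemp
    obtain ⟨K, hK⟩ := exists_nat_gt (C * (r ^ 4 * (1 + Real.log (1 + r)) ^ 4))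
    have h1 := hnot (K + 1) (Nat.le_add_left 1 K) (by simp [hemp])
    push_cast at h1
    linarith
  have hmem := Nat.sInf_mem hne
  have hK : ((sInf S : ℕ) : ℝ) ≤ 1 + C * (r ^ 2 * (1 + Real.log (1 + r)) ^ 2) ^ 2 := by
    rw [show (r ^ 2 * (1 + Real.log (1 + r)) ^ 2) ^ 2 = r ^ 4 * (1 + Real.log (1 + r)) ^ 4 by ring]
    rcases Nat.lt_or_ge (sInf S) 2 with hlt | hge
    · have h1 : ((sInf S : ℕ) : ℝ) ≤ 1 := by exact_mod_cast Nat.lt_succ_iff.1 hlt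
      have : 0 ≤ C * (r ^ 4 * (1 + Real.log (1 + r)) ^ 4) := by positivity
      linarith
    -- By minimality no iterate among the first K_ε − 1 is stationary, so the bound applies to K_ε −
    -- 1, which is at least 1 here.
    · have h1 := hnot (sInf S - 1) (by omega) (Nat.notMem_of_lt_sInf (by omega))
      rw [Nat.cast_sub (by omega), Nat.cast_one] at h1
      linarith
  refine ⟨sInf S, ⟨hmem, fun K hKS => Nat.sInf_le hKS⟩, ?_,
    hw.updateTime_le_timeBound hp h hmem.1,
    three_mul_natSqrt_add_one_le hC (by positivity) hK⟩
  rw [show (r ^ 2 * (1 + Real.log (1 + r)) ^ 2) ^ 2 = r ^ 4 * (1 + Real.log (1 + r)) ^ 4 by ring]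
    at hK
  have : 0 ≤ r ^ 4 * (1 + Real.log (1 + r)) ^ 4 := by positivity
  nlinarith
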